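/- Let $N\ge 1$ and $a_0,b_0\ge 0$ be integers with $a_0+b_0\ge 1$, and let $\mu_1,\mu_2$ be probability measures on $\mathbb{Z}$ such that $-1\le x\le N$ for $\mu_1$-almost every $x$ and $-1\le N-x\le N$ for $\mu_2$-almost every $x$. Consider an urn that initially contains $a_0$ white and $b_0$ black balls. At each step a ball is drawn uniformly at random, given the past, and is put back; if it is white (resp. black), then $B$ white balls and $N-B$ black balls are added, where, given the past and the colour drawn, $B$ has law $\mu_1$ (resp. $\mu_2$); adding $-1$ ball means removing one. Let $a_n$ be the number of white balls added at step $n\ge 1$ and $S_n=a_1+\dots+a_n$, so that the urn contains $a_0+S_n$ white balls among $a_0+b_0+nN$ balls after $n$ steps. Put $m_{i,k}=\int x^k\,d\mu_i(x)$, $\alpha_k=\frac{m_{2,k}-m_{1,k}}{N}$, $\rho=\frac{m_{1,1}-m_{2,1}}{N}=-\alpha_1$, $D_k=m_{2,k}$, $\ell=\frac{D_1}{\alpha_1+1}$, $D=D_2-\ell(\ell+\alpha_2)$, $r_i=\frac{m_{i,1}}{N}$, $v_i=\frac{m_{i,2}}{N^2}-r_i^2$ (the variance of $B/N$ when $B$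 has law $\mu_i$), and $$R=r_2\alpha_1^2(1-r_1),\qquad S=(\alpha_1+1)\bigl(v_2(1-r_1)+v_1r_2\bigr).$$ Assume that $\rho<\frac12$. Then: 1. $R\ge 0$, $S\ge 0$, and $$\frac{D}{2\alpha_1+1}=\frac{N^2(R+S)}{(2\alpha_1+1)(\alpha_1+1)^2}.$$ 2. $D=0$ if and only if one of the following degenerate cases occurs: $\mu_1=\delta_N$; or $\mu_2=\delta_0$; or $\mu_1=\mu_2=\delta_k$ for some integer $k$. 3. In all other cases $\frac{D}{2\alpha_1+1}>0$, and both $\frac{S_n-n\ell}{\sqrt n}$ and $\frac{(a_0+S_n)-n\ell}{\sqrt n}$ converge in distribution, as $n\to\infty$, to $\mathcal{N}\bigl(0,\frac{D}{2\alpha_1+1}\bigr)$. -/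

import Mathlib

open MeasureTheory ProbabilityTheory Filter

noncomputable section

namespace PolyaUrn

/-- The `k`-th moment `m_k = ∫ x ^ k dμ` of a law `μ` on the integers. -/
def mom (μ : Measure ℤ) (k : ℕ) : ℝ := ∫ x, (x : ℝ) ^ k ∂μ

/-- `α_k = (m_{2,k} - m_{1,k}) / N`. -/
def alpha (N : ℕ) (μ₁ μ₂ : Measure ℤ) (k : ℕ) : ℝ := (mom μ₂ k - mom μ₁ k) / N

/-- `ρ = (m_{1,1} - m_{2,1}) / N`, the quotient of the eigenvalues of the mean replacement
matrix. -/
def rho (N : ℕ) (μ₁ μ₂ : Measure ℤ) : ℝ := (mom μ₁ 1 - mom μ₂ 1) / N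

/-- `ℓ = D_1 / (α_1 + 1)` with `D_1 = m_{2,1}`. -/
def ell (N : ℕ) (μ₁ μ₂ : Measure ℤ) : ℝ := mom μ₂ 1 / (alpha N μ₁ μ₂ 1 + 1)

/-- `D = D_2 - ℓ (ℓ + α_2)` with `D_2 = m_{2,2}`. -/
def D (N : ℕ) (μ₁ μ₂ : Measure ℤ) : ℝ :=
  mom μ₂ 2 - ell N μ₁ μ₂ * (ell N μ₁ μ₂ + alpha N μ₁ μ₂ 2)

/-- `r = m_1 / N`. -/
def r (N : ℕ) (μ : Measure ℤ) : ℝ := mom μ 1 / N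

/-- `v`, the variance of `B / N` when `B` has law `μ`. -/
def v (N : ℕ) (μ : Measure ℤ) : ℝ := Var[fun x : ℤ => (x : ℝ) / N; μ]

/-- `R = r_2 α_1² (1 - r_1)`. -/
def R (N : ℕ) (μ₁ μ₂ : Measure ℤ) : ℝ := r N μ₂ * alpha N μ₁ μ₂ 1 ^ 2 * (1 - r N μ₁)

/-- `S = (α_1 + 1) (v_2 (1 - r_1) + v_1 r_2)`. -/
def S (N : ℕ) (μ₁ μ₂ : Measure ℤ) : ℝ :=
  (alpha N μ₁ μ₂ 1 + 1) * (v N μ₂ * (1 - r N μ₁) + v N μ₁ * r N μ₂)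

/-- The replacement laws allowed: `μ₁` (resp. `μ₂`) is the law of the number of white balls added
after a white (resp. black) ball was drawn and put back; the remaining ones of the `N` added balls
are black. Only one ball, of the drawn colour, may be removed. -/
structure IsReplacement (N : ℕ) (μ₁ μ₂ : Measure ℤ) : Prop where
  white : ∀ᵐ x : ℤ ∂μ₁, -1 ≤ x ∧ x ≤ (N : ℤ)
  black : ∀ᵐ x : ℤ ∂μ₂, -1 ≤ (N : ℤ) - x ∧ (N : ℤ) - x ≤ (N : ℤ)

variable {Ω : Type*}

/-- `S_n = a_1 + ⋯ + a_n`, the increase of the number of white balls in the first `n` steps;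
`a i` is the number of white balls added by the step that leads from time `i` to time `i + 1`. -/
def totalAdded (a : ℕ → Ω → ℤ) (n : ℕ) (ω : Ω) : ℤ := ∑ i ∈ Finset.range n, a i ω

/-- The number of white balls in the urn at time `n`. -/
def whiteBalls (a₀ : ℕ) (a : ℕ → Ω → ℤ) (n : ℕ) (ω : Ω) : ℤ := a₀ + totalAdded a n ω

/-- The information available at time `n`: colours drawn and numbers of balls added in the first
`n` steps. -/
@[reducible] def history (c : ℕ → Ω → Bool) (a : ℕ → Ω → ℤ) (n : ℕ) : MeasurableSpace Ω :=
  ⨆ i ∈ Finset.range n, MeasurableSpace.comap (fun ω => (c i ω, a i ω)) inferInstance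

/-- The dynamics of the two-colour urn that starts with `a₀` white and `b₀` black balls. In the step
from time `n` to time `n + 1`, `c n` is the colour drawn (`true` for white, `false` for black) and
`a n` the number of white balls added. Given the history, a ball of the urn is drawn uniformly at
random; given the history and the colour drawn, the number of white balls added has law `μ₁` or
`μ₂` according to that colour. -/
structure IsUrn [MeasurableSpace Ω] (N a₀ b₀ : ℕ) (μ₁ μ₂ : Measure ℤ) (P : Measure Ω)
    (c : ℕ → Ω → Bool) (a : ℕ → Ω → ℤ) : Prop where
  measurable_colour : ∀ n, Measurable (c n)
  measurable_added : ∀ n, Measurable (a n)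
  draw : ∀ n, P⟦{ω | c n ω = true} | history c a n⟧ =ᵐ[P]
    fun ω => (whiteBalls a₀ a n ω : ℝ) / ((a₀ : ℝ) + b₀ + n * N)
  add : ∀ (n : ℕ) (k : ℤ),
    P⟦{ω | a n ω = k} | history c a n ⊔ MeasurableSpace.comap (c n) inferInstance⟧ =ᵐ[P]
      fun ω => if c n ω = true then μ₁.real {k} else μ₂.real {k}

/-- The degenerate replacement laws. -/
def IsDegenerate (N : ℕ) (μ₁ μ₂ : Measure ℤ) : Prop :=
  μ₁ = Measure.dirac (N : ℤ) ∨ μ₂ = Measure.dirac 0 ∨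
    ∃ k : ℤ, μ₁ = Measure.dirac k ∧ μ₂ = Measure.dirac k

end PolyaUrn

end

/-!
Let `W_n` be the number of white balls, `m = n + τ` with `τ = (a₀ + b₀) / N`, and put
`X_n = W_n - ℓ m`. The fraction of white balls is `(ℓ + X_n / m) / N`, so the choice of `ℓ` gives
the exact identity `X_{n+1} = (1 - α₁ / m) X_n + ξ_n` with bounded martingale differences `ξ_n`, and
the conditional variance of `ξ_n` is `D + O(|X_n| / m)` (`IsUrn.isStochasticApproximation`). Such a
recursion is a stochastic approximation scheme (`IsStochasticApproximation`), and the hypothesis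
`ρ < 1/2`, that is `α₁ > -1/2`, says that its noise dominates its memory.

Characteristic functions yield the central limit theorem for such schemes. Second moments give
`X_n / m → 0` in `L²`. Hence `φ_n(t) = E exp (i t X_n)` satisfies
`φ_{n+1}(t) = φ_n((1 - α₁ / m) t) (1 - t² D / 2) + t² o(1)` for `t = O(1 / √n)`
(`IsStochasticApproximation.norm_charFun_step_le`). The Gaussian functions
`g_n(t) = exp (-t² σ m / 2)` with `σ = D / (2 α₁ + 1)` satisfy the same approximate recursion. The
difference of the two is controlled by a deterministic recursion (`tendsto_of_recursion`), in which
the factors `(1 - α₁ / m)²` cost less than the growth of `m` because `α₁ > -1/2`. The conclusion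
is Lévy's continuity theorem (`IsStochasticApproximation.tendstoInDistribution`).

The formula for `D` is an algebraic identity once the moments are written through `r_i` and `v_i`
(`D_eq`). The signs of `R` and `S` come from `r₁ ≤ 1` and `r₂ ≥ 0`, and the equality cases of these
bounds and of `v_i ≥ 0` give the degenerate laws (`D_eq_zero_iff`).
-/

namespace PolyaUrn

open scoped Topology

/-! ### Deterministic recursions -/

/-- A sequence with `x_{n+1} ≤ (1 - κ / (n + τ + 1)) x_n + o(1 / n)` has nonpositive upper limit,
because the harmonic series diverges. -/
theorem eventually_le_of_recursion {κ τ : ℝ} (hκ : 0 < κ) (hτ : 0 < τ) {x ε : ℕ → ℝ}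
    (hε : Tendsto ε atTop (𝓝 0))
    (hx : ∀ᶠ n : ℕ in atTop,
      x (n + 1) ≤ (1 - κ / (n + τ + 1)) * x n + ε n / (n + τ + 1))
    {η : ℝ} (hη : 0 < η) : ∀ᶠ n in atTop, x n ≤ η := by
  have hlarge : ∀ᶠ n : ℕ in atTop, κ ≤ (n : ℝ) :=
    tendsto_natCast_atTop_atTop.eventually_ge_atTop κ
  have hsmall : ∀ᶠ n : ℕ in atTop, ε n < κ * (η / 2) := hε.eventually_lt_const (by positivity)
  obtain ⟨n₀, hn₀⟩ := eventually_atTop.1 (hx.and (hlarge.and hsmall))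
  set H : ℕ → ℝ := fun n => ∑ k ∈ Finset.range n, 1 / ((k : ℝ) + τ + 1) with hH
  have hHtop : Tendsto H atTop atTop := by
    have h1 := Real.tendsto_sum_range_one_div_nat_succ_atTop.const_mul_atTop
      (show (0 : ℝ) < 1 / (1 + τ) by positivity)
    refine tendsto_atTop_mono (fun n => ?_) h1
    rw [hH, Finset.mul_sum]
    refine Finset.sum_le_sum fun k _ => ?_
    rw [div_mul_div_comm, one_mul]
    refine one_div_le_one_div_of_le (by positivity) ?_
    nlinarith [mul_nonneg hτ.le (Nat.cast_nonneg (α := ℝ) k)]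
  -- the excess of `x` over `η / 2` is multiplied by at most `1 - κ / (n + τ + 1)` in each step
  have key : ∀ n ≥ n₀, x n - η / 2 ≤
      |x n₀ - η / 2| * Real.exp (κ * H n₀) * Real.exp (-(κ * H n)) := by
    intro n hn
    induction n, hn using Nat.le_induction with
    | base =>
      rw [mul_assoc, ← Real.exp_add, add_neg_cancel, Real.exp_zero, mul_one]
      exact le_abs_self _
    | succ n hn ih =>
      obtain ⟨h1, h2, h3⟩ := hn₀ n hn
      have hm : 0 < (n : ℝ) + τ + 1 := by positivity
      have hq : 0 ≤ 1 - κ / (n + τ + 1) := by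
        rw [sub_nonneg, div_le_one hm]; linarith
      have hexp : 1 - κ / (n + τ + 1) ≤ Real.exp (-(κ * (1 / ((n : ℝ) + τ + 1)))) := by
        have := Real.add_one_le_exp (-(κ * (1 / ((n : ℝ) + τ + 1))))
        rw [mul_one_div] at this ⊢
        linarith
      have hstep : x (n + 1) - η / 2 ≤ (1 - κ / (n + τ + 1)) * (x n - η / 2) := by
        have : ε n / (n + τ + 1) ≤ κ / (n + τ + 1) * (η / 2) := by
          rw [div_mul_eq_mul_div]; gcongr
        linarith
      calc x (n + 1) - η / 2 ≤ (1 - κ / (n + τ + 1)) * (x n - η / 2) := hstep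
        _ ≤ (1 - κ / (n + τ + 1)) *
            (|x n₀ - η / 2| * Real.exp (κ * H n₀) * Real.exp (-(κ * H n))) := by gcongr
        _ ≤ Real.exp (-(κ * (1 / ((n : ℝ) + τ + 1)))) *
            (|x n₀ - η / 2| * Real.exp (κ * H n₀) * Real.exp (-(κ * H n))) := by gcongr
        _ = _ := by
          have : H (n + 1) = H n + 1 / ((n : ℝ) + τ + 1) := Finset.sum_range_succ _ _
          rw [this, mul_add κ, neg_add, Real.exp_add]
          ring
  have hlim : Tendsto (fun n => |x n₀ - η / 2| * Real.exp (κ * H n₀) * Real.exp (-(κ * H n)))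
      atTop (𝓝 0) := by
    simpa using (Real.tendsto_exp_neg_atTop_nhds_zero.comp
      (hHtop.const_mul_atTop hκ)).const_mul (|x n₀ - η / 2| * Real.exp (κ * H n₀))
  filter_upwards [hlim.eventually_lt_const (half_pos hη), eventually_ge_atTop n₀] with n h1 h2
  linarith [key n h2]

/-- The place where `α > -1/2` is needed: the weights `n + τ` absorb the factors
`(1 - α / (n + τ)) ^ 2`, with room `1/2 + α` to spare. -/
theorem eventually_contraction {α τ : ℝ} (hα : -(1 / 2) < α) (hτ : 0 < τ) :
    ∀ᶠ n : ℕ in atTop, (1 - α / (n + τ)) ^ 2 * (n + τ) ≤ n + τ + 1 - (1 / 2 + α) := by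
  have h : ∀ᶠ n : ℕ in atTop, α ^ 2 / (1 / 2 + α) ≤ (n : ℝ) :=
    tendsto_natCast_atTop_atTop.eventually_ge_atTop _
  filter_upwards [h] with n hn
  have hm : 0 < (n : ℝ) + τ := by positivity
  have h1 : α ^ 2 / (n + τ) ≤ 1 / 2 + α := by
    rw [div_le_iff₀ (by linarith)] at hn
    rw [div_le_iff₀ hm]
    nlinarith
  have h2 : (1 - α / (n + τ)) ^ 2 * (n + τ) = n + τ - 2 * α + α ^ 2 / (n + τ) := by
    field_simp
    ring
  linarith

theorem tendsto_const_div_natCast_add (C τ : ℝ) :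
    Tendsto (fun n : ℕ => C / ((n : ℝ) + τ)) atTop (𝓝 0) :=
  Tendsto.const_div_atTop (tendsto_atTop_add_const_right _ τ tendsto_natCast_atTop_atTop) C

/-- The Gaussian characteristic functions `t ↦ exp (-t² σ (n + τ) / 2)`, `σ = D / (2 α + 1)`,
satisfy the recursion of `tendsto_of_recursion` up to an error `t² · O(1 / n)`: the exponents at
`n + 1, t` and at `n, (1 - α / (n + τ)) t` differ by `-t² (D - σ α² / (n + τ)) / 2`. -/
theorem abs_exp_sub_le {α τ D K t : ℝ} {n : ℕ} (hα : -(1 / 2) < α) (hτ : 0 < τ) (hD : 0 ≤ D)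
    (hc : (1 - α / (n + τ)) ^ 2 * (n + τ) ≤ n + τ + 1 - (1 / 2 + α))
    (ht : t ^ 2 * (n + τ + 1) ≤ K) (hK : K * D ≤ n + τ + 1) :
    |Real.exp (-(t ^ 2 * (D / (2 * α + 1)) * (n + τ + 1) / 2)) -
      Real.exp (-(((1 - α / (n + τ)) * t) ^ 2 * (D / (2 * α + 1)) * (n + τ) / 2)) *
        (1 - t ^ 2 * D / 2)| ≤
      t ^ 2 * (K * D ^ 2 / (n + τ + 1) + D / (2 * α + 1) * α ^ 2 / (n + τ)) := by
  have hm : 0 < (n : ℝ) + τ := by positivity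
  have hα' : 0 < 2 * α + 1 := by linarith
  set m : ℝ := (n : ℝ) + τ with hmdef
  set σ : ℝ := D / (2 * α + 1) with hσ
  have hσ0 : 0 ≤ σ := by positivity
  set y : ℝ := t ^ 2 * D / 2 - t ^ 2 * (σ * α ^ 2 / m) / 2 with hy
  have hexp : Real.exp (-(t ^ 2 * σ * (m + 1) / 2)) =
      Real.exp (-(((1 - α / m) * t) ^ 2 * σ * m / 2)) * Real.exp (-y) := by
    rw [← Real.exp_add]
    congr 1
    have hD' : D = σ * (2 * α + 1) := by rw [hσ]; field_simp
    rw [hy, hD']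
    field_simp
    ring
  have hy' : y = t ^ 2 * σ / 2 * (m + 1 - (1 - α / m) ^ 2 * m) := by
    have hD' : D = σ * (2 * α + 1) := by rw [hσ]; field_simp
    rw [hy, hD']
    field_simp
    ring
  have hy0 : 0 ≤ y := by
    rw [hy']
    have : 0 ≤ m + 1 - (1 - α / m) ^ 2 * m := by linarith
    positivity
  have hyle : y ≤ t ^ 2 * D / 2 := by
    have : 0 ≤ t ^ 2 * (σ * α ^ 2 / m) / 2 := by positivity
    linarith
  have htm : t ^ 2 ≤ K / (m + 1) := by rwa [le_div_iff₀ (by positivity)]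
  have hy1 : y ≤ 1 := by
    have : t ^ 2 * D ≤ 1 := by
      calc t ^ 2 * D ≤ K / (m + 1) * D := by gcongr
        _ = K * D / (m + 1) := by ring
        _ ≤ 1 := by rw [div_le_one (by positivity)]; exact hK
    linarith
  have hb := Real.abs_exp_sub_one_sub_id_le (x := -y)
    (by rw [abs_neg, abs_of_nonneg hy0]; exact hy1)
  have hsq : y ^ 2 ≤ t ^ 2 * (K * D ^ 2 / (m + 1)) := by
    calc y ^ 2 ≤ (t ^ 2 * D / 2) ^ 2 := by gcongr
      _ = t ^ 2 * (t ^ 2 * D ^ 2 / 4) := by ring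
      _ ≤ t ^ 2 * (t ^ 2 * D ^ 2) := by
        gcongr
        have : 0 ≤ t ^ 2 * D ^ 2 := by positivity
        linarith
      _ ≤ t ^ 2 * (K / (m + 1) * D ^ 2) := by gcongr
      _ = _ := by ring
  rw [hexp, ← mul_sub, abs_mul, Real.abs_exp]
  have hg : Real.exp (-(((1 - α / m) * t) ^ 2 * σ * m / 2)) ≤ 1 := by
    rw [Real.exp_le_one_iff]
    have : 0 ≤ ((1 - α / m) * t) ^ 2 * σ * m / 2 := by positivity
    linarith
  have hmain : |Real.exp (-y) - (1 - t ^ 2 * D / 2)| ≤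
      t ^ 2 * (K * D ^ 2 / (m + 1) + σ * α ^ 2 / m) := by
    have h0 : 0 ≤ t ^ 2 * (σ * α ^ 2 / m) := by positivity
    rw [abs_le] at hb ⊢
    constructor <;> nlinarith
  calc _ ≤ 1 * |Real.exp (-y) - (1 - t ^ 2 * D / 2)| := by gcongr
    _ ≤ _ := by rw [one_mul]; exact hmain

/-- If, for `t` of order `1 / √n`, functions `φ_n` satisfy
`φ_{n+1}(t) = φ_n((1 - α / (n + τ)) t) (1 - t² D / 2) + t² · o(1)`, then `φ_n(t / √n)` tends to the
characteristic function of the centred Gaussian law with variance `D / (2 α + 1)`. -/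
theorem tendsto_of_recursion {φ : ℕ → ℝ → ℂ} {α τ D : ℝ} (hα : -(1 / 2) < α) (hτ : 0 < τ)
    (hD : 0 ≤ D) (hlip : ∀ n, ∃ C, ∀ t, ‖φ n t - 1‖ ≤ C * |t|)
    (hrec : ∀ K : ℝ, ∃ δ : ℕ → ℝ, Tendsto δ atTop (𝓝 0) ∧ ∀ᶠ n : ℕ in atTop,
      ∀ t : ℝ, t ^ 2 * (n + τ + 1) ≤ K →
        ‖φ (n + 1) t - φ n ((1 - α / (n + τ)) * t) * ((1 - t ^ 2 * D / 2 : ℝ) : ℂ)‖ ≤ t ^ 2 * δ n)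
    (t : ℝ) :
    Tendsto (fun n : ℕ => φ n (t / √(n : ℝ))) atTop
      (𝓝 ((Real.exp (-(t ^ 2 * (D / (2 * α + 1)) / 2)) : ℝ) : ℂ)) := by
  set σ : ℝ := D / (2 * α + 1) with hσ
  have hα' : 0 < 2 * α + 1 := by linarith
  have hσ0 : 0 ≤ σ := by positivity
  set g : ℕ → ℝ → ℝ := fun n t => Real.exp (-(t ^ 2 * σ * (n + τ) / 2)) with hg
  set K : ℝ := t ^ 2 * (1 + τ) with hK
  obtain ⟨δ₀, hδ₀, hφ⟩ := hrec K
  have hK0 : 0 ≤ K := by positivity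
  set δ : ℕ → ℝ := fun n => |δ₀ n| + (K * D ^ 2 / (n + τ + 1) + σ * α ^ 2 / (n + τ)) with hδ
  have hδlim : Tendsto δ atTop (𝓝 0) := by
    have h1 := tendsto_const_div_natCast_add (K * D ^ 2) (τ + 1)
    have h2 := tendsto_const_div_natCast_add (σ * α ^ 2) τ
    simpa [hδ, add_assoc] using hδ₀.abs.add (h1.add h2)
  have hδ0 : ∀ n, 0 ≤ δ n := fun n => by positivity
  have hlarge : ∀ᶠ n : ℕ in atTop, K * D ≤ (n : ℝ) :=
    tendsto_natCast_atTop_atTop.eventually_ge_atTop _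
  obtain ⟨n₀, hn₀⟩ := eventually_atTop.1 (hφ.and ((eventually_contraction hα hτ).and hlarge))
  -- The error `‖φ n s - g n s‖` is kept below `η + s² c n`, where
  -- `c (n + 1) = (1 - α / (n + τ))² c n + δ n`, so that `c n = o(n)`. The constant `η` pays for the
  -- initial error, which is only linear in `s`.
  have hclose : ∀ η : ℝ, 0 < η → ∀ᶠ n : ℕ in atTop, ∀ s : ℝ, s ^ 2 * (n + τ) ≤ K →
      ‖φ n s - (g n s : ℂ)‖ ≤ η + s ^ 2 * (n + τ) * η := by
    intro η hη
    obtain ⟨C₀, hC₀⟩ := hlip n₀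
    set C : ℝ := C₀ ^ 2 / (4 * η) + σ * (n₀ + τ) / 2 with hC
    let c : ℕ → ℝ := fun n => Nat.rec C
      (fun k ck => if k < n₀ then C else (1 - α / (k + τ)) ^ 2 * ck + δ k) n
    have hc0 : ∀ n ≤ n₀, c n = C := by
      intro n hn
      cases n with
      | zero => rfl
      | succ k => exact if_pos (by omega)
    have hcs : ∀ n ≥ n₀, c (n + 1) = (1 - α / (n + τ)) ^ 2 * c n + δ n :=
      fun n hn => if_neg (by omega)
    have hind : ∀ n ≥ n₀, ∀ s : ℝ, s ^ 2 * (n + τ) ≤ K →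
        ‖φ n s - (g n s : ℂ)‖ ≤ η + s ^ 2 * c n := by
      intro n hn
      induction n, hn using Nat.le_induction with
      | base =>
        intro s _
        have h1 : ‖φ n₀ s - 1‖ ≤ η + s ^ 2 * (C₀ ^ 2 / (4 * η)) := by
          refine (hC₀ s).trans ?_
          -- arithmetic-geometric mean inequality for `C₀ |s| ≤ η + s² C₀² / (4 η)`
          have h : 0 ≤ (C₀ * |s| / 2 - η) ^ 2 / η := by positivity
          have h' : (C₀ * |s| / 2 - η) ^ 2 / η =
              s ^ 2 * (C₀ ^ 2 / (4 * η)) - C₀ * |s| + η := by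
            rw [← sq_abs s]
            field_simp
            ring
          linarith
        have h2 : ‖(1 : ℂ) - (g n₀ s : ℂ)‖ ≤ s ^ 2 * (σ * (n₀ + τ) / 2) := by
          rw [← Complex.ofReal_one, ← Complex.ofReal_sub, Complex.norm_real, Real.norm_eq_abs]
          have h3 := Real.add_one_le_exp (-(s ^ 2 * σ * (n₀ + τ) / 2))
          have h4 : g n₀ s ≤ 1 := by
            rw [hg, Real.exp_le_one_iff]
            have : 0 ≤ s ^ 2 * σ * (n₀ + τ) / 2 := by positivity
            linarith
          rw [abs_of_nonneg (by linarith)]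
          simp only [hg]
          linarith
        rw [hc0 n₀ le_rfl, hC, mul_add]
        calc ‖φ n₀ s - (g n₀ s : ℂ)‖ = ‖(φ n₀ s - 1) + (1 - (g n₀ s : ℂ))‖ := by congr 1; ring
          _ ≤ _ := norm_add_le _ _
          _ ≤ _ := by linarith
      | succ n hn ih =>
        intro s hs
        obtain ⟨h1, h2, h3⟩ := hn₀ n hn
        have hm : 0 < (n : ℝ) + τ := by positivity
        push_cast at hs
        have hs' : s ^ 2 * (n + τ + 1) ≤ K := by linarith
        set q : ℝ := 1 - α / (n + τ) with hq
        -- the region `s² (n + τ) ≤ K` is preserved when passing from `n + 1, s` to `n, q s`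
        have hqs : (q * s) ^ 2 * (n + τ) ≤ K := by
          calc (q * s) ^ 2 * (n + τ) = s ^ 2 * (q ^ 2 * (n + τ)) := by ring
            _ ≤ s ^ 2 * (n + τ + 1) := by gcongr; linarith
            _ ≤ K := hs'
        have e1 := (h1 s hs').trans (mul_le_mul_of_nonneg_left (le_abs_self _) (sq_nonneg s))
        have e2 := ih (q * s) hqs
        have e3 := abs_exp_sub_le hα hτ hD h2 hs' (by linarith)
        have hfac : |1 - s ^ 2 * D / 2| ≤ 1 := by
          have hsD : s ^ 2 * D ≤ 1 := by
            have : s ^ 2 ≤ K / (n + τ + 1) := by rwa [le_div_iff₀ (by positivity)]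
            calc s ^ 2 * D ≤ K / (n + τ + 1) * D := by gcongr
              _ = K * D / (n + τ + 1) := by ring
              _ ≤ 1 := by rw [div_le_one (by positivity)]; linarith
          have : 0 ≤ s ^ 2 * D := by positivity
          rw [abs_le]; constructor <;> linarith
        have e4 : ‖(φ n (q * s) - (g n (q * s) : ℂ)) * ((1 - s ^ 2 * D / 2 : ℝ) : ℂ)‖ ≤
            η + (q * s) ^ 2 * c n := by
          rw [norm_mul, Complex.norm_real, Real.norm_eq_abs]
          calc _ ≤ ‖φ n (q * s) - (g n (q * s) : ℂ)‖ * 1 := by gcongr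
            _ ≤ _ := by rw [mul_one]; exact e2
        have e5 : ‖(g n (q * s) : ℂ) * ((1 - s ^ 2 * D / 2 : ℝ) : ℂ) - (g (n + 1) s : ℂ)‖ ≤
            s ^ 2 * (K * D ^ 2 / (n + τ + 1) + σ * α ^ 2 / (n + τ)) := by
          rw [← Complex.ofReal_mul, ← Complex.ofReal_sub, Complex.norm_real, Real.norm_eq_abs,
            abs_sub_comm]
          convert e3 using 6
          push_cast
          ring
        rw [hcs n hn]
        calc ‖φ (n + 1) s - (g (n + 1) s : ℂ)‖
            = ‖(φ (n + 1) s - φ n (q * s) * ((1 - s ^ 2 * D / 2 : ℝ) : ℂ)) +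
              (φ n (q * s) - (g n (q * s) : ℂ)) * ((1 - s ^ 2 * D / 2 : ℝ) : ℂ) +
              ((g n (q * s) : ℂ) * ((1 - s ^ 2 * D / 2 : ℝ) : ℂ) - (g (n + 1) s : ℂ))‖ := by
              congr 1; ring
          _ ≤ _ := norm_add₃_le
          _ ≤ s ^ 2 * |δ₀ n| + (η + (q * s) ^ 2 * c n) +
              s ^ 2 * (K * D ^ 2 / (n + τ + 1) + σ * α ^ 2 / (n + τ)) := by gcongr
          _ = _ := by simp only [hδ]; ring
    have hcsmall : ∀ᶠ n : ℕ in atTop, c n / (n + τ) ≤ η := by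
      have hcnn : ∀ n, 0 ≤ c n := by
        have hC0 : 0 ≤ C := by positivity
        intro n
        rcases le_total n n₀ with hn | hn
        · rw [hc0 n hn]; exact hC0
        · induction n, hn using Nat.le_induction with
          | base => rw [hc0 n₀ le_rfl]; exact hC0
          | succ n hn ih => rw [hcs n hn]; have := hδ0 n; positivity
      refine eventually_le_of_recursion (κ := 1 / 2 + α) (by linarith) hτ hδlim ?_ hη
      filter_upwards [eventually_ge_atTop n₀] with n hn
      have hm : 0 < (n : ℝ) + τ := by positivity
      have h2 := (hn₀ n hn).2.1
      push_cast
      rw [hcs n hn, add_right_comm (n : ℝ) 1 τ, add_div]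
      gcongr
      calc (1 - α / (n + τ)) ^ 2 * c n / (n + τ + 1)
          = (1 - α / (n + τ)) ^ 2 * (n + τ) * (c n / (n + τ)) / (n + τ + 1) := by field_simp
        _ ≤ (n + τ + 1 - (1 / 2 + α)) * (c n / (n + τ)) / (n + τ + 1) := by
          have := hcnn n
          gcongr
        _ = _ := by field_simp
    filter_upwards [hcsmall, eventually_ge_atTop n₀] with n h1 h2 s hs
    have hm : 0 < (n : ℝ) + τ := by positivity
    rw [div_le_iff₀ hm] at h1
    refine (hind n h2 s hs).trans ?_
    have : s ^ 2 * c n ≤ s ^ 2 * (η * (n + τ)) := by gcongr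
    linarith
  -- specialization to `s = t / √n`
  have hsq : ∀ n : ℕ, 1 ≤ n → (t / √(n : ℝ)) ^ 2 * (n + τ) = t ^ 2 * (1 + τ / n) := by
    intro n hn
    have : 0 < (n : ℝ) := by exact_mod_cast hn
    rw [div_pow, Real.sq_sqrt this.le]
    field_simp
  have hgauss : Tendsto (fun n : ℕ => (g n (t / √(n : ℝ)) : ℂ)) atTop
      (𝓝 ((Real.exp (-(t ^ 2 * σ / 2)) : ℝ) : ℂ)) := by
    refine (Complex.continuous_ofReal.tendsto _).comp
      ((Real.continuous_exp.tendsto _).comp ?_)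
    have h1 : Tendsto (fun n : ℕ => -(t ^ 2 * (1 + τ / (n : ℝ)) * σ / 2)) atTop
        (𝓝 (-(t ^ 2 * (1 + 0) * σ / 2))) :=
      ((((tendsto_const_div_atTop_nhds_zero_nat τ).const_add 1).const_mul (t ^ 2)).mul_const
        σ |>.div_const 2).neg
    rw [add_zero, mul_one] at h1
    refine h1.congr' ?_
    filter_upwards [eventually_ge_atTop 1] with n hn
    rw [← hsq n hn]
    ring
  have hdiff : Tendsto (fun n : ℕ => φ n (t / √(n : ℝ)) - (g n (t / √(n : ℝ)) : ℂ)) atTop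
      (𝓝 0) := by
    rw [Metric.tendsto_nhds]
    intro ε hε
    have hη : 0 < ε / (2 * (1 + K)) := by positivity
    filter_upwards [hclose _ hη, eventually_ge_atTop 1] with n h1 hn
    have hle : (t / √(n : ℝ)) ^ 2 * (n + τ) ≤ K := by
      rw [hsq n hn, hK]
      gcongr
      exact div_le_self hτ.le (by exact_mod_cast hn)
    rw [dist_zero_right]
    calc _ ≤ _ := h1 _ hle
      _ ≤ ε / (2 * (1 + K)) + K * (ε / (2 * (1 + K))) := by gcongr
      _ = ε / 2 := by field_simp
      _ < ε := half_lt_self hε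
  simpa using hdiff.add hgauss

/-! ### A central limit theorem for stochastic approximation -/

/-- The noise `ξ_n = X_{n+1} - (1 - α / (n + τ)) X_n` of a process that is pulled towards `0` at
rate `α / (n + τ)`. -/
noncomputable def noise {Ω : Type*} (α τ : ℝ) (X : ℕ → Ω → ℝ) (n : ℕ) (ω : Ω) : ℝ :=
  X (n + 1) ω - (1 - α / (n + τ)) * X n ω

/-- The process `X` satisfies `X_{n+1} = (1 - α / (n + τ)) X_n + ξ_n`, where the `ξ_n` are uniformly
bounded martingale differences with respect to `F` whose conditional variance differs from `D` by
`O(|X_n| / n)`. -/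
structure IsStochasticApproximation {Ω : Type*} [mΩ : MeasurableSpace Ω] (P : Measure Ω)
    (F : ℕ → MeasurableSpace Ω) (α τ D : ℝ) (X : ℕ → Ω → ℝ) : Prop where
  le : ∀ n, F n ≤ mΩ
  measurable : ∀ n, Measurable[F n] (X n)
  bounded_zero : ∃ M, ∀ᵐ ω ∂P, |X 0 ω| ≤ M
  bounded_noise : ∃ M, ∀ n, ∀ᵐ ω ∂P, |noise α τ X n ω| ≤ M
  condExp_noise : ∀ n, P[noise α τ X n | F n] =ᵐ[P] 0
  condExp_noise_sq : ∃ C, ∀ n, ∀ᵐ ω ∂P,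
    |P[fun ω => noise α τ X n ω ^ 2 | F n] ω - D| ≤ C * (|X n ω| / (n + τ))

theorem norm_exp_I_mul_sub_taylor_le {x : ℝ} (hx : |x| ≤ 1) :
    ‖Complex.exp (Complex.I * x) - (1 + Complex.I * x - (x : ℂ) ^ 2 / 2)‖ ≤ |x| ^ 3 := by
  have hn : ‖Complex.I * (x : ℂ)‖ = |x| := by simp
  have h := Complex.exp_bound (x := Complex.I * x) (by rwa [hn]) (n := 3) (by norm_num)
  have hs : ∑ m ∈ Finset.range 3, (Complex.I * (x : ℂ)) ^ m / (m.factorial : ℂ) =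
      1 + Complex.I * x - (x : ℂ) ^ 2 / 2 := by
    simp [Finset.sum_range_succ, mul_pow, Nat.factorial]
    ring
  rw [hs, hn] at h
  refine h.trans (mul_le_of_le_one_right (by positivity) ?_)
  norm_num [Nat.factorial]

theorem integral_condExp_smul {Ω E : Type*} {m mΩ : MeasurableSpace Ω} {P : Measure Ω}
    [IsFiniteMeasure P] [NormedAddCommGroup E] [NormedSpace ℝ E] [CompleteSpace E]
    (hm : m ≤ mΩ) {f : Ω → ℝ} {g : Ω → E} (hf : Integrable f P) (hg : StronglyMeasurable[m] g)
    {C : ℝ} (hC : ∀ ω, ‖g ω‖ ≤ C) :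
    ∫ ω, f ω • g ω ∂P = ∫ ω, P[f | m] ω • g ω ∂P := by
  have hfg : Integrable (f • g) P :=
    hf.smul_of_top_left (memLp_top_of_bound (hg.mono hm).aestronglyMeasurable C (.of_forall hC))
  rw [← integral_condExp hm (f := fun ω => f ω • g ω)]
  exact integral_congr_ae
    (condExp_smul_of_aestronglyMeasurable_right hf hfg hg.aestronglyMeasurable)

namespace IsStochasticApproximation

variable {Ω : Type*} [mΩ : MeasurableSpace Ω] {P : Measure Ω}
  {F : ℕ → MeasurableSpace Ω} {α τ D : ℝ} {X : ℕ → Ω → ℝ}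

theorem measurable' (h : IsStochasticApproximation P F α τ D X) (n : ℕ) : Measurable (X n) :=
  (h.measurable n).mono (h.le n) le_rfl

theorem measurable_noise (h : IsStochasticApproximation P F α τ D X) (n : ℕ) :
    Measurable (noise α τ X n) :=
  (h.measurable' (n + 1)).sub ((h.measurable' n).const_mul _)

theorem bounded (h : IsStochasticApproximation P F α τ D X) (n : ℕ) :
    ∃ M, ∀ᵐ ω ∂P, |X n ω| ≤ M := by
  induction n with
  | zero => exact h.bounded_zero
  | succ n ih =>
    obtain ⟨M, hM⟩ := ih
    obtain ⟨M', hM'⟩ := h.bounded_noise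
    refine ⟨M' + |1 - α / (n + τ)| * M, ?_⟩
    filter_upwards [hM, hM' n] with ω h1 h2
    have : X (n + 1) ω = noise α τ X n ω + (1 - α / (n + τ)) * X n ω := by
      simp [noise]
    rw [this]
    refine (abs_add_le _ _).trans ?_
    rw [abs_mul]
    gcongr

variable [IsProbabilityMeasure P]

theorem memLp (h : IsStochasticApproximation P F α τ D X) (n : ℕ) (p : ENNReal) :
    MemLp (X n) p P := by
  obtain ⟨M, hM⟩ := h.bounded n
  exact (memLp_top_of_bound (h.measurable' n).aestronglyMeasurable M hM).mono_exponent le_top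

theorem memLp_noise (h : IsStochasticApproximation P F α τ D X) (n : ℕ) (p : ENNReal) :
    MemLp (noise α τ X n) p P := by
  obtain ⟨M, hM⟩ := h.bounded_noise
  exact (memLp_top_of_bound (h.measurable_noise n).aestronglyMeasurable M (hM n)).mono_exponent
    le_top

theorem integral_mul_noise (h : IsStochasticApproximation P F α τ D X) (n : ℕ) :
    ∫ ω, X n ω * noise α τ X n ω ∂P = 0 := by
  rw [← integral_condExp (h.le n) (f := fun ω => X n ω * noise α τ X n ω)]
  refine integral_eq_zero_of_ae ?_
  have hint : Integrable (X n * noise α τ X n) P := (h.memLp n 2).integrable_mul (h.memLp_noise n 2)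
  have := condExp_mul_of_stronglyMeasurable_left (m := F n) (μ := P)
    (h.measurable n).stronglyMeasurable hint ((h.memLp_noise n 1).integrable le_rfl)
  filter_upwards [this, h.condExp_noise n] with ω h1 h2
  refine h1.trans ?_
  simp [h2]

theorem integral_sq_succ_le (h : IsStochasticApproximation P F α τ D X) {M : ℝ} (hM : ∀ n,
    ∀ᵐ ω ∂P, |noise α τ X n ω| ≤ M) (n : ℕ) :
    ∫ ω, X (n + 1) ω ^ 2 ∂P ≤ (1 - α / (n + τ)) ^ 2 * ∫ ω, X n ω ^ 2 ∂P + M ^ 2 := by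
  have h1 : Integrable (fun ω => X n ω ^ 2) P := (h.memLp n 2).integrable_sq
  have h2 : Integrable (fun ω => noise α τ X n ω ^ 2) P := (h.memLp_noise n 2).integrable_sq
  have h3 : Integrable (fun ω => X n ω * noise α τ X n ω) P :=
    (h.memLp n 2).integrable_mul (h.memLp_noise n 2)
  have hnoise : ∫ ω, noise α τ X n ω ^ 2 ∂P ≤ M ^ 2 := by
    have : ∫ ω, noise α τ X n ω ^ 2 ∂P ≤ ∫ _, M ^ 2 ∂P := by
      refine integral_mono_ae h2 (integrable_const _) ?_
      filter_upwards [hM n] with ω hω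
      exact sq_le_sq' (abs_le.1 hω).1 (abs_le.1 hω).2
    simpa using this
  have heq : ∫ ω, X (n + 1) ω ^ 2 ∂P = ∫ ω, ((1 - α / (n + τ)) ^ 2 * X n ω ^ 2 +
      2 * (1 - α / (n + τ)) * (X n ω * noise α τ X n ω) + noise α τ X n ω ^ 2) ∂P := by
    congr 1 with ω
    simp only [noise]
    ring
  have h4 : Integrable (fun ω => (1 - α / (n + τ)) ^ 2 * X n ω ^ 2 +
      2 * (1 - α / (n + τ)) * (X n ω * noise α τ X n ω)) P :=
    (h1.const_mul _).add (h3.const_mul _)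
  rw [heq, integral_add h4 h2, integral_add (h1.const_mul _) (h3.const_mul _),
    integral_const_mul, integral_const_mul,
    h.integral_mul_noise]
  linarith

/-- `X_n = o(n)` in `L²`; this makes the conditional variance of the noise converge to `D`. -/
theorem tendsto_integral_sq (h : IsStochasticApproximation P F α τ D X) (hα : -(1 / 2) < α)
    (hτ : 0 < τ) :
    Tendsto (fun n : ℕ => (∫ ω, X n ω ^ 2 ∂P) / (n + τ) ^ 2) atTop (𝓝 0) := by
  obtain ⟨M, hM⟩ := h.bounded_noise
  have hnn : ∀ n, 0 ≤ ∫ ω, X n ω ^ 2 ∂P := fun n => integral_nonneg fun ω => sq_nonneg _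
  have hev : ∀ η : ℝ, 0 < η → ∀ᶠ n : ℕ in atTop, (∫ ω, X n ω ^ 2 ∂P) / (n + τ) ^ 2 ≤ η := by
    intro η hη
    refine eventually_le_of_recursion (κ := 1 / 2 + α) (ε := fun n => M ^ 2 / (n + (τ + 1)))
      (by linarith) hτ (tendsto_const_div_natCast_add _ _) ?_ hη
    filter_upwards [eventually_contraction hα hτ] with n hn
    have hm : 0 < (n : ℝ) + τ := by positivity
    have hE := hnn n
    push_cast
    rw [add_right_comm (n : ℝ) 1 τ, ← add_assoc]
    calc (∫ ω, X (n + 1) ω ^ 2 ∂P) / (n + τ + 1) ^ 2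
        ≤ ((1 - α / (n + τ)) ^ 2 * ∫ ω, X n ω ^ 2 ∂P + M ^ 2) / (n + τ + 1) ^ 2 := by
          gcongr
          exact h.integral_sq_succ_le hM n
      _ = (1 - α / (n + τ)) ^ 2 * (n + τ) * (n + τ) *
            ((∫ ω, X n ω ^ 2 ∂P) / (n + τ) ^ 2) / (n + τ + 1) ^ 2 +
            M ^ 2 / (n + τ + 1) / (n + τ + 1) := by
          field_simp
      _ ≤ (n + τ + 1 - (1 / 2 + α)) * (n + τ + 1) *
            ((∫ ω, X n ω ^ 2 ∂P) / (n + τ) ^ 2) / (n + τ + 1) ^ 2 +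
            M ^ 2 / (n + τ + 1) / (n + τ + 1) := by
          have h0 : 0 ≤ (1 - α / (n + τ)) ^ 2 * (n + τ) := by positivity
          have h1 : 0 ≤ (n : ℝ) + τ + 1 - (1 / 2 + α) := h0.trans hn
          gcongr ?_ * ?_ * _ / _ + _
          linarith
      _ = _ := by field_simp
  rw [Metric.tendsto_nhds]
  intro ε hε
  filter_upwards [hev _ (half_pos hε)] with n hn
  have := hnn n
  rw [dist_zero_right, Real.norm_eq_abs, abs_of_nonneg (by positivity)]
  linarith

theorem integral_abs_le_sqrt (h : IsStochasticApproximation P F α τ D X) (n : ℕ) :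
    ∫ ω, |X n ω| ∂P ≤ √(∫ ω, X n ω ^ 2 ∂P) := by
  refine Real.le_sqrt_of_sq_le ?_
  have h1 := variance_eq_sub (μ := P) (h.memLp n 2).abs
  have h2 := variance_nonneg (fun ω => |X n ω|) P
  have h3 : ∫ ω, (|X n| ^ 2) ω ∂P = ∫ ω, X n ω ^ 2 ∂P := by simp
  rw [h3] at h1
  change Var[fun ω => |X n ω|; P] = _ - (∫ ω, |X n ω| ∂P) ^ 2 at h1
  linarith

theorem norm_integral_cexp_sub_one_le (h : IsStochasticApproximation P F α τ D X) (n : ℕ) :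
    ∃ C, ∀ t : ℝ, ‖∫ ω, Complex.exp (Complex.I * ((t * X n ω : ℝ) : ℂ)) ∂P - 1‖ ≤ C * |t| := by
  obtain ⟨M, hM⟩ := h.bounded n
  refine ⟨M, fun t => ?_⟩
  have hint : Integrable (fun ω => Complex.exp (Complex.I * ((t * X n ω : ℝ) : ℂ))) P := by
    refine Integrable.of_bound (C := 1) ?_ (.of_forall fun ω => ?_)
    · have := h.measurable' n
      fun_prop
    · rw [mul_comm, Complex.norm_exp_ofReal_mul_I]
  have h1 : ∫ ω, Complex.exp (Complex.I * ((t * X n ω : ℝ) : ℂ)) ∂P - 1 =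
      ∫ ω, (Complex.exp (Complex.I * ((t * X n ω : ℝ) : ℂ)) - 1) ∂P := by
    rw [integral_sub hint (integrable_const _)]
    simp
  rw [h1]
  refine (norm_integral_le_of_norm_le_const (C := M * |t|) ?_).trans_eq (by simp)
  filter_upwards [hM] with ω hω
  refine (Real.norm_exp_I_mul_ofReal_sub_one_le).trans ?_
  rw [Real.norm_eq_abs, abs_mul, mul_comm]
  gcongr

/-- One step of the characteristic function of `X`: conditionally on the past, the noise has mean
`0` and variance close to `D`, so it contributes a factor `1 - t² D / 2`. -/
theorem norm_charFun_step_le (h : IsStochasticApproximation P F α τ D X) {M C : ℝ}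
    (hM : ∀ n, ∀ᵐ ω ∂P, |noise α τ X n ω| ≤ M)
    (hC : ∀ n, ∀ᵐ ω ∂P,
      |P[fun ω => noise α τ X n ω ^ 2 | F n] ω - D| ≤ C * (|X n ω| / (n + τ)))
    (hC0 : 0 ≤ C) (hτ : 0 < τ) (n : ℕ) (t : ℝ) (ht : |t| * M ≤ 1) :
    ‖∫ ω, Complex.exp (Complex.I * ((t * X (n + 1) ω : ℝ) : ℂ)) ∂P -
      (∫ ω, Complex.exp (Complex.I * ((((1 - α / (n + τ)) * t) * X n ω : ℝ) : ℂ)) ∂P) *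
        ((1 - t ^ 2 * D / 2 : ℝ) : ℂ)‖ ≤
      t ^ 2 * (|t| * M ^ 3 + C * (√(∫ ω, X n ω ^ 2 ∂P) / (n + τ))) := by
  have hM0 : 0 ≤ M := by
    obtain ⟨ω, hω⟩ := (hM 0).exists
    exact (abs_nonneg _).trans hω
  set s : ℝ := (1 - α / (n + τ)) * t with hs
  set ξ : Ω → ℝ := noise α τ X n with hξ
  set V : Ω → ℝ := P[fun ω => ξ ω ^ 2 | F n] with hV
  set ψ : Ω → ℂ := fun ω => Complex.exp (Complex.I * ((s * X n ω : ℝ) : ℂ)) with hψ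
  have hψn : ∀ ω, ‖ψ ω‖ = 1 := fun ω => by
    rw [hψ]
    simp only
    rw [mul_comm, Complex.norm_exp_ofReal_mul_I]
  have hψF : StronglyMeasurable[F n] ψ := by
    have h1 : Measurable fun x : ℝ => Complex.exp (Complex.I * ((s * x : ℝ) : ℂ)) := by fun_prop
    exact (h1.comp (h.measurable n)).stronglyMeasurable
  have hψm : AEStronglyMeasurable ψ P := (hψF.mono (h.le n)).aestronglyMeasurable
  have hξm : Measurable ξ := h.measurable_noise n
  have hξ1 : Integrable ξ P := (h.memLp_noise n 1).integrable le_rfl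
  have hξ2 : Integrable (fun ω => ξ ω ^ 2) P := (h.memLp_noise n 2).integrable_sq
  have hψtop : MemLp ψ ⊤ P := memLp_top_of_bound hψm 1 (.of_forall fun ω => (hψn ω).le)
  have hψint : Integrable ψ P := hψtop.integrable le_top
  have i1 : Integrable (fun ω => ξ ω • ψ ω) P := hξ1.smul_of_top_left hψtop
  have i2 : Integrable (fun ω => ξ ω ^ 2 • ψ ω) P := hξ2.smul_of_top_left hψtop
  have hV1 : Integrable V P := integrable_condExp
  have i3 : Integrable (fun ω => V ω • ψ ω) P := hV1.smul_of_top_left hψtop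
  have e1 : ∫ ω, ξ ω • ψ ω ∂P = 0 := by
    rw [integral_condExp_smul (h.le n) hξ1 hψF (fun ω => (hψn ω).le)]
    refine integral_eq_zero_of_ae ?_
    filter_upwards [h.condExp_noise n] with ω hω
    rw [hω]
    simp
  have e2 : ∫ ω, ξ ω ^ 2 • ψ ω ∂P = ∫ ω, V ω • ψ ω ∂P :=
    integral_condExp_smul (h.le n) hξ2 hψF (fun ω => (hψn ω).le)
  -- the Taylor remainder of `exp (I t ξ)`
  set A : Ω → ℂ := fun ω => ψ ω * (Complex.exp (Complex.I * ((t * ξ ω : ℝ) : ℂ)) -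
    (1 + Complex.I * ((t * ξ ω : ℝ) : ℂ) - ((t * ξ ω : ℝ) : ℂ) ^ 2 / 2)) with hA
  have hAle : ∀ᵐ ω ∂P, ‖A ω‖ ≤ |t| ^ 3 * M ^ 3 := by
    filter_upwards [hM n] with ω hω
    have hle : |t * ξ ω| ≤ |t| * M := by rw [abs_mul]; gcongr
    rw [hA]
    simp only
    rw [norm_mul, hψn, one_mul, ← mul_pow]
    refine (norm_exp_I_mul_sub_taylor_le (hle.trans ht)).trans ?_
    gcongr
  have iA : Integrable A P := by
    refine Integrable.of_bound ?_ _ hAle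
    exact hψm.mul (by fun_prop)
  have hdecomp : ∀ ω, Complex.exp (Complex.I * ((t * X (n + 1) ω : ℝ) : ℂ)) =
      A ω + (Complex.I * t) * (ξ ω • ψ ω) - ((t ^ 2 / 2 : ℝ) : ℂ) * (ξ ω ^ 2 • ψ ω) + ψ ω := by
    intro ω
    have hX : t * X (n + 1) ω = s * X n ω + t * ξ ω := by
      simp only [hξ, noise, hs]
      ring
    have hexp : Complex.exp (Complex.I * ((t * X (n + 1) ω : ℝ) : ℂ)) =
        ψ ω * Complex.exp (Complex.I * ((t * ξ ω : ℝ) : ℂ)) := by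
      rw [hX, hψ, ← Complex.exp_add]
      push_cast
      ring_nf
    rw [hexp, hA]
    simp only [Complex.real_smul]
    push_cast
    ring
  have hint : ∫ ω, Complex.exp (Complex.I * ((t * X (n + 1) ω : ℝ) : ℂ)) ∂P =
      ∫ ω, A ω ∂P - ((t ^ 2 / 2 : ℝ) : ℂ) * ∫ ω, V ω • ψ ω ∂P + ∫ ω, ψ ω ∂P := by
    have j1 : Integrable (fun ω => A ω + (Complex.I * t) * (ξ ω • ψ ω)) P :=
      iA.add (i1.const_mul _)
    have j2 : Integrable (fun ω => A ω + (Complex.I * t) * (ξ ω • ψ ω) -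
        ((t ^ 2 / 2 : ℝ) : ℂ) * (ξ ω ^ 2 • ψ ω)) P := j1.sub (i2.const_mul _)
    simp_rw [hdecomp]
    rw [integral_add j2 hψint, integral_sub j1 (i2.const_mul _), integral_add iA (i1.const_mul _),
      integral_const_mul, integral_const_mul, e1, e2]
    ring
  have hdev : ∫ ω, V ω • ψ ω ∂P - (D : ℂ) * ∫ ω, ψ ω ∂P = ∫ ω, (V ω - D) • ψ ω ∂P := by
    rw [← integral_const_mul, ← integral_sub i3 (hψint.const_mul _)]
    congr 1 with ω
    simp only [Complex.real_smul]
    push_cast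
    ring
  have hdevle : ‖∫ ω, (V ω - D) • ψ ω ∂P‖ ≤ C * (√(∫ ω, X n ω ^ 2 ∂P) / (n + τ)) := by
    have hX1 : Integrable (fun ω => |X n ω|) P := ((h.memLp n 1).integrable le_rfl).abs
    calc ‖∫ ω, (V ω - D) • ψ ω ∂P‖ ≤ ∫ ω, C * (|X n ω| / (n + τ)) ∂P := by
          refine norm_integral_le_of_norm_le ((hX1.div_const _).const_mul _) ?_
          filter_upwards [hC n] with ω hω
          rw [norm_smul, hψn, mul_one, Real.norm_eq_abs]
          exact hω
      _ = C * ((∫ ω, |X n ω| ∂P) / (n + τ)) := by rw [integral_const_mul, integral_div]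
      _ ≤ _ := by
          gcongr
          exact h.integral_abs_le_sqrt n
  have hAint : ‖∫ ω, A ω ∂P‖ ≤ |t| ^ 3 * M ^ 3 := by
    simpa using norm_integral_le_of_norm_le_const hAle
  have hsplit : ∫ ω, Complex.exp (Complex.I * ((t * X (n + 1) ω : ℝ) : ℂ)) ∂P -
      (∫ ω, ψ ω ∂P) * ((1 - t ^ 2 * D / 2 : ℝ) : ℂ) =
      ∫ ω, A ω ∂P - ((t ^ 2 / 2 : ℝ) : ℂ) * ∫ ω, (V ω - D) • ψ ω ∂P := by
    rw [hint, ← hdev]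
    push_cast
    ring
  rw [hsplit]
  calc _ ≤ ‖∫ ω, A ω ∂P‖ + ‖((t ^ 2 / 2 : ℝ) : ℂ) * ∫ ω, (V ω - D) • ψ ω ∂P‖ := norm_sub_le _ _
    _ ≤ |t| ^ 3 * M ^ 3 + t ^ 2 / 2 * (C * (√(∫ ω, X n ω ^ 2 ∂P) / (n + τ))) := by
      rw [norm_mul, Complex.norm_real, Real.norm_eq_abs, abs_of_nonneg (by positivity)]
      gcongr
    _ ≤ |t| ^ 3 * M ^ 3 + t ^ 2 * (C * (√(∫ ω, X n ω ^ 2 ∂P) / (n + τ))) := by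
      gcongr
      exact half_le_self (sq_nonneg t)
    _ = _ := by
      rw [← sq_abs t]
      ring

theorem tendsto_integral_cexp (h : IsStochasticApproximation P F α τ D X) (hα : -(1 / 2) < α)
    (hτ : 0 < τ) (hD : 0 ≤ D) (t : ℝ) :
    Tendsto (fun n : ℕ =>
      ∫ ω, Complex.exp (Complex.I * ((t / √(n : ℝ) * X n ω : ℝ) : ℂ)) ∂P) atTop
      (𝓝 ((Real.exp (-(t ^ 2 * (D / (2 * α + 1)) / 2)) : ℝ) : ℂ)) := by
  obtain ⟨M, hM⟩ := h.bounded_noise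
  obtain ⟨C, hC⟩ := h.condExp_noise_sq
  have hC' : ∀ n, ∀ᵐ ω ∂P,
      |P[fun ω => noise α τ X n ω ^ 2 | F n] ω - D| ≤ |C| * (|X n ω| / (n + τ)) := by
    intro n
    filter_upwards [hC n] with ω hω
    refine hω.trans ?_
    gcongr
    exact le_abs_self C
  have hM0 : 0 ≤ M := by
    obtain ⟨ω, hω⟩ := (hM 0).exists
    exact (abs_nonneg _).trans hω
  refine tendsto_of_recursion
    (φ := fun n t => ∫ ω, Complex.exp (Complex.I * ((t * X n ω : ℝ) : ℂ)) ∂P) hα hτ hD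
    h.norm_integral_cexp_sub_one_le (fun K => ?_) t
  have hKlim : Tendsto (fun n : ℕ => √(K / (n + (τ + 1)))) atTop (𝓝 0) := by
    simpa using (tendsto_const_div_natCast_add K (τ + 1)).sqrt
  have hXlim : Tendsto (fun n : ℕ => √(∫ ω, X n ω ^ 2 ∂P) / (n + τ)) atTop (𝓝 0) := by
    have h1 := (h.tendsto_integral_sq hα hτ).sqrt
    rw [Real.sqrt_zero] at h1
    refine h1.congr fun n => ?_
    rw [Real.sqrt_div' _ (sq_nonneg _), Real.sqrt_sq (by positivity)]
  refine ⟨fun n => √(K / (n + (τ + 1))) * M ^ 3 + |C| * (√(∫ ω, X n ω ^ 2 ∂P) / (n + τ)), ?_, ?_⟩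
  · simpa using (hKlim.mul_const (M ^ 3)).add (hXlim.const_mul |C|)
  · have hsmall : ∀ᶠ n : ℕ in atTop, √(K / (n + (τ + 1))) * M < 1 := by
      have := hKlim.mul_const M
      rw [zero_mul] at this
      exact this.eventually_lt_const one_pos
    filter_upwards [hsmall] with n hn t ht
    have htle : |t| ≤ √(K / (n + (τ + 1))) := by
      refine Real.abs_le_sqrt ?_
      rw [le_div_iff₀ (by positivity), ← add_assoc]
      exact ht
    refine (h.norm_charFun_step_le hM hC' (abs_nonneg C) hτ n t ?_).trans ?_
    · exact (mul_le_mul_of_nonneg_right htle hM0).trans hn.le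
    · gcongr

/-- Central limit theorem for a stochastic approximation scheme with step sizes `α / (n + τ)`,
`α > -1/2`; a bounded deterministic correction does not change the limit. -/
theorem tendstoInDistribution (h : IsStochasticApproximation P F α τ D X) (hα : -(1 / 2) < α)
    (hτ : 0 < τ) (hD : 0 ≤ D) (b : ℝ) :
    TendstoInDistribution (fun (n : ℕ) ω => (X n ω + b) / √(n : ℝ)) atTop (id : ℝ → ℝ)
      (fun _ => P) (gaussianReal 0 (D / (2 * α + 1)).toNNReal) := by
  have hmeas : ∀ n : ℕ, Measurable (fun ω => (X n ω + b) / √(n : ℝ)) := fun n =>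
    ((h.measurable' n).add_const b).div_const _
  refine ⟨fun n => (hmeas n).aemeasurable, aemeasurable_id, ?_⟩
  refine ProbabilityMeasure.tendsto_iff_tendsto_charFun.2 fun t => ?_
  have hσ : 0 ≤ D / (2 * α + 1) := div_nonneg hD (by linarith)
  have hlim : Tendsto (fun n : ℕ => Complex.exp (Complex.I * ((t * (b / √(n : ℝ)) : ℝ) : ℂ)) *
      ∫ ω, Complex.exp (Complex.I * ((t / √(n : ℝ) * X n ω : ℝ) : ℂ)) ∂P) atTop
      (𝓝 (1 * ((Real.exp (-(t ^ 2 * (D / (2 * α + 1)) / 2)) : ℝ) : ℂ))) := by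
    refine Tendsto.mul ?_ (h.tendsto_integral_cexp hα hτ hD t)
    have h1 : Tendsto (fun n : ℕ => t * (b / √(n : ℝ))) atTop (𝓝 0) := by
      simpa using (Tendsto.const_div_atTop
        (Real.tendsto_sqrt_atTop.comp tendsto_natCast_atTop_atTop) b).const_mul t
    have h2 : Continuous fun x : ℝ => Complex.exp (Complex.I * (x : ℂ)) := by fun_prop
    have h3 : Complex.exp (Complex.I * ((0 : ℝ) : ℂ)) = 1 := by simp
    rw [← h3]
    exact (h2.tendsto 0).comp h1
  convert hlim using 2 with n
  · simp only [ProbabilityMeasure.coe_mk]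
    rw [charFun_apply_real, integral_map (hmeas n).aemeasurable (by fun_prop),
      ← integral_const_mul]
    congr 1 with ω
    rw [← Complex.exp_add]
    congr 1
    push_cast
    ring
  · simp only [ProbabilityMeasure.coe_mk, Measure.map_id]
    rw [charFun_gaussianReal, one_mul, Complex.ofReal_exp, Real.coe_toNNReal _ hσ]
    congr 1
    push_cast
    ring

end IsStochasticApproximation

/-! ### Moments of the replacement laws -/

section Moments

variable {N : ℕ} {μ μ₁ μ₂ : Measure ℤ}

theorem IsReplacement.ae_mem_white (h : IsReplacement N μ₁ μ₂) :
    ∀ᵐ x ∂μ₁, x ∈ Finset.Icc (-1 : ℤ) (N + 1) := by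
  filter_upwards [h.white] with x hx
  rw [Finset.mem_Icc]
  omega

theorem IsReplacement.ae_mem_black (h : IsReplacement N μ₁ μ₂) :
    ∀ᵐ x ∂μ₂, x ∈ Finset.Icc (-1 : ℤ) (N + 1) := by
  filter_upwards [h.black] with x hx
  rw [Finset.mem_Icc]
  omega

theorem mom_eq_sum [IsFiniteMeasure μ] {s : Finset ℤ} (h : ∀ᵐ x ∂μ, x ∈ s) (j : ℕ) :
    mom μ j = ∑ k ∈ s, (k : ℝ) ^ j * μ.real {k} := by
  have h1 : mom μ j = ∫ x in s, (x : ℝ) ^ j ∂μ := by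
    rw [mom, Measure.restrict_eq_self_of_ae_mem (s := (s : Set ℤ)) h]
  rw [h1, setIntegral_finset s (Integrable.integrableOn ?_)]
  · simp [mul_comm]
  · refine Integrable.of_bound (by fun_prop) (∑ k ∈ s, |(k : ℝ) ^ j|) ?_
    filter_upwards [h] with x hx
    exact Finset.single_le_sum (f := fun k : ℤ => |(k : ℝ) ^ j|) (fun _ _ => abs_nonneg _) hx

theorem memLp_intCast [IsFiniteMeasure μ] {s : Finset ℤ} (h : ∀ᵐ x ∂μ, x ∈ s) (p : ENNReal) :
    MemLp (fun x : ℤ => (x : ℝ)) p μ := by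
  refine MemLp.mono_exponent (memLp_top_of_bound (by fun_prop) (∑ k ∈ s, |(k : ℝ)|) ?_) le_top
  filter_upwards [h] with x hx
  exact Finset.single_le_sum (f := fun k : ℤ => |(k : ℝ)|) (fun _ _ => abs_nonneg _) hx

end Moments

/-! ### The urn as a stochastic approximation scheme -/

section Trajectory

variable {Ω : Type*}

/-- The fraction of white balls in the urn at time `n`, the conditional probability of drawing a
white ball. -/
noncomputable def whiteFraction (N a₀ b₀ : ℕ) (a : ℕ → Ω → ℤ) (n : ℕ) (ω : Ω) : ℝ :=
  (whiteBalls a₀ a n ω : ℝ) / ((a₀ : ℝ) + b₀ + n * N)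

/-- The centred number of white balls `W_n - l T_n / N`, where `T_n = a₀ + b₀ + n N` is the size of
the urn. Centring by `l T_n / N` instead of `l n` makes the drift exactly linear. -/
noncomputable def centred (N a₀ b₀ : ℕ) (l : ℝ) (a : ℕ → Ω → ℤ) (n : ℕ) (ω : Ω) : ℝ :=
  (whiteBalls a₀ a n ω : ℝ) - l * (n + ((a₀ : ℝ) + b₀) / N)

theorem measurable_whiteBalls {a₀ : ℕ} (c : ℕ → Ω → Bool) (a : ℕ → Ω → ℤ) (n : ℕ) :
    Measurable[history c a n] (whiteBalls a₀ a n) := by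
  have h1 : ∀ i ∈ Finset.range n, Measurable[history c a n] (a i) := by
    intro i hi
    have h2 : Measurable[history c a n] (fun ω => (c i ω, a i ω)) :=
      measurable_iff_comap_le.2 (le_iSup₂_of_le i hi le_rfl)
    exact measurable_snd.comp h2
  have h3 : Measurable[history c a n] (totalAdded a n) := by
    unfold totalAdded
    exact Finset.measurable_fun_sum _ h1
  exact h3.const_add _

end Trajectory

section Urn

variable {Ω : Type*} [mΩ : MeasurableSpace Ω] {P : Measure Ω} {N a₀ b₀ : ℕ} {μ₁ μ₂ : Measure ℤ}
  {c : ℕ → Ω → Bool} {a : ℕ → Ω → ℤ}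

namespace IsUrn

theorem history_le (h : IsUrn N a₀ b₀ μ₁ μ₂ P c a) (n : ℕ) : history c a n ≤ mΩ :=
  iSup₂_le fun i _ => ((h.measurable_colour i).prodMk (h.measurable_added i)).comap_le

variable [IsProbabilityMeasure P]

theorem whiteFraction_mem_Icc (h : IsUrn N a₀ b₀ μ₁ μ₂ P c a) (n : ℕ) :
    ∀ᵐ ω ∂P, whiteFraction N a₀ b₀ a n ω ∈ Set.Icc (0 : ℝ) 1 := by
  have hs : MeasurableSet {ω | c n ω = true} := h.measurable_colour n (measurableSet_singleton true)
  have hint : Integrable ({ω | c n ω = true}.indicator fun _ => (1 : ℝ)) P :=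
    (integrable_const 1).indicator hs
  have h0 : (0 : Ω → ℝ) ≤ᵐ[P] P⟦{ω | c n ω = true} | history c a n⟧ :=
    condExp_nonneg (.of_forall fun ω => Set.indicator_nonneg (fun _ _ => zero_le_one) ω)
  have h1 : P⟦{ω | c n ω = true} | history c a n⟧ ≤ᵐ[P] P[fun _ => (1 : ℝ) | history c a n] :=
    condExp_mono hint (integrable_const 1)
      (.of_forall fun ω => Set.indicator_le_self' (fun _ _ => zero_le_one) ω)
  rw [condExp_const (h.history_le n)] at h1
  filter_upwards [h0, h1, h.draw n] with ω h0 h1 h2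
  rw [h2] at h0 h1
  exact ⟨h0, h1⟩

/-- The conditional law of the number of added white balls given the history alone is the mixture of
`μ₁` and `μ₂` with the fractions of white and black balls as weights. -/
theorem condExp_added_eq (h : IsUrn N a₀ b₀ μ₁ μ₂ P c a) (n : ℕ) (k : ℤ) :
    P⟦{ω | a n ω = k} | history c a n⟧ =ᵐ[P] fun ω =>
      whiteFraction N a₀ b₀ a n ω * μ₁.real {k} +
        (1 - whiteFraction N a₀ b₀ a n ω) * μ₂.real {k} := by
  have hle : history c a n ⊔ MeasurableSpace.comap (c n) inferInstance ≤ mΩ :=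
    sup_le (h.history_le n) (h.measurable_colour n).comap_le
  have hs : MeasurableSet {ω | c n ω = true} := h.measurable_colour n (measurableSet_singleton true)
  have hint : Integrable ({ω | c n ω = true}.indicator fun _ => (1 : ℝ)) P :=
    (integrable_const 1).indicator hs
  have e1 := condExp_condExp_of_le (μ := P) (f := {ω | a n ω = k}.indicator fun _ => (1 : ℝ))
    (le_sup_left : history c a n ≤ history c a n ⊔ MeasurableSpace.comap (c n) inferInstance) hle
  have e2 : (fun ω => if c n ω = true then μ₁.real {k} else μ₂.real {k}) =
      (fun _ => μ₂.real {k}) + (μ₁.real {k} - μ₂.real {k}) •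
        ({ω | c n ω = true}.indicator fun _ => (1 : ℝ)) := by
    ext ω
    by_cases hc : c n ω = true <;> simp [hc]
  have e3 := condExp_congr_ae (m := history c a n) (h.add n k)
  rw [e2] at e3
  have e4 := condExp_add (μ := P) (integrable_const (μ₂.real {k}))
    (hint.smul (μ₁.real {k} - μ₂.real {k})) (history c a n)
  have e5 := condExp_smul (μ := P) (μ₁.real {k} - μ₂.real {k})
    ({ω | c n ω = true}.indicator fun _ => (1 : ℝ)) (history c a n)
  filter_upwards [e1, e3, e4, e5, h.draw n] with ω e1 e3 e4 e5 e6
  rw [← e1, e3, e4, Pi.add_apply, e5, condExp_const (h.history_le n), Pi.smul_apply, e6]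
  simp only [whiteFraction, smul_eq_mul]
  ring

theorem added_mem (h : IsUrn N a₀ b₀ μ₁ μ₂ P c a) (hμ : IsReplacement N μ₁ μ₂) (n : ℕ) :
    ∀ᵐ ω ∂P, a n ω ∈ Finset.Icc (-1 : ℤ) (N + 1) := by
  have hk : ∀ k : ℤ, ∀ᵐ ω ∂P, k ∉ Finset.Icc (-1 : ℤ) (N + 1) → a n ω ≠ k := by
    intro k
    by_cases hkm : k ∈ Finset.Icc (-1 : ℤ) (N + 1)
    · exact .of_forall fun ω h => absurd hkm h
    have z1 : μ₁.real {k} = 0 := by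
      rw [measureReal_def, measure_mono_null (fun x hx => ?_) hμ.ae_mem_white, ENNReal.toReal_zero]
      rw [Set.mem_singleton_iff] at hx
      subst hx
      exact hkm
    have z2 : μ₂.real {k} = 0 := by
      rw [measureReal_def, measure_mono_null (fun x hx => ?_) hμ.ae_mem_black, ENNReal.toReal_zero]
      rw [Set.mem_singleton_iff] at hx
      subst hx
      exact hkm
    have hms : MeasurableSet {ω | a n ω = k} := h.measurable_added n (measurableSet_singleton k)
    have hP : P.real {ω | a n ω = k} = 0 := by
      rw [← integral_indicator_one hms, ← integral_condExp (h.history_le n)]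
      refine integral_eq_zero_of_ae ?_
      filter_upwards [h.condExp_added_eq n k] with ω hω
      refine hω.trans ?_
      simp [z1, z2]
    have hP' : P {ω | a n ω = k} = 0 := (measureReal_eq_zero_iff).1 hP
    filter_upwards [measure_eq_zero_iff_ae_notMem.1 hP'] with ω hω _
    exact hω
  filter_upwards [ae_all_iff.2 hk] with ω hω
  by_contra hc
  exact hω _ hc rfl

theorem memLp_added (h : IsUrn N a₀ b₀ μ₁ μ₂ P c a) (hμ : IsReplacement N μ₁ μ₂) (n : ℕ)
    (p : ENNReal) : MemLp (fun ω => (a n ω : ℝ)) p P := by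
  have hm := h.measurable_added n
  refine MemLp.mono_exponent (memLp_top_of_bound (C := N + 1) ?_ ?_) le_top
  · exact (by fun_prop : Measurable fun ω => (a n ω : ℝ)).aestronglyMeasurable
  · filter_upwards [h.added_mem hμ n] with ω hω
    rw [Finset.mem_Icc] at hω
    have h1 : (-1 : ℝ) ≤ a n ω := by exact_mod_cast hω.1
    have h2 : (a n ω : ℝ) ≤ N + 1 := by exact_mod_cast hω.2
    rw [Real.norm_eq_abs, abs_le]
    constructor <;> linarith [(Nat.cast_nonneg N : (0 : ℝ) ≤ N)]

theorem condExp_added_pow [IsFiniteMeasure μ₁] [IsFiniteMeasure μ₂]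
    (h : IsUrn N a₀ b₀ μ₁ μ₂ P c a) (hμ : IsReplacement N μ₁ μ₂) (n j : ℕ) :
    P[fun ω => (a n ω : ℝ) ^ j | history c a n] =ᵐ[P] fun ω =>
      whiteFraction N a₀ b₀ a n ω * mom μ₁ j + (1 - whiteFraction N a₀ b₀ a n ω) * mom μ₂ j := by
  set I : Finset ℤ := Finset.Icc (-1 : ℤ) (N + 1) with hI
  have hms : ∀ k, MeasurableSet {ω | a n ω = k} := fun k =>
    h.measurable_added n (measurableSet_singleton k)
  have e1 : (fun ω => (a n ω : ℝ) ^ j) =ᵐ[P]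
      ∑ k ∈ I, ((k : ℝ) ^ j) • ({ω | a n ω = k}.indicator fun _ => (1 : ℝ)) := by
    filter_upwards [h.added_mem hμ n] with ω hω
    rw [Finset.sum_apply, Finset.sum_eq_single_of_mem (a n ω) hω]
    · simp
    · intro k _ hk
      simp [Ne.symm hk]
  have e2 := condExp_finsetSum (μ := P) (s := I)
    (f := fun k => ((k : ℝ) ^ j) • ({ω | a n ω = k}.indicator fun _ => (1 : ℝ)))
    (fun k _ => ((integrable_const 1).indicator (hms k)).smul _) (history c a n)
  have e3 : ∀ᵐ ω ∂P, ∀ k : ℤ,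
      P[((k : ℝ) ^ j) • ({ω | a n ω = k}.indicator fun _ => (1 : ℝ)) | history c a n] ω =
        (k : ℝ) ^ j * (whiteFraction N a₀ b₀ a n ω * μ₁.real {k} +
          (1 - whiteFraction N a₀ b₀ a n ω) * μ₂.real {k}) := by
    refine ae_all_iff.2 fun k => ?_
    filter_upwards [condExp_smul (μ := P) ((k : ℝ) ^ j)
      ({ω | a n ω = k}.indicator fun _ => (1 : ℝ)) (history c a n), h.condExp_added_eq n k]
      with ω h1 h2
    rw [h1, Pi.smul_apply, h2, smul_eq_mul]
  filter_upwards [condExp_congr_ae (m := history c a n) e1, e2, e3] with ω e1 e2 e3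
  rw [e1, e2, Finset.sum_apply, Finset.sum_congr rfl fun k _ => e3 k,
    mom_eq_sum hμ.ae_mem_white, mom_eq_sum hμ.ae_mem_black, Finset.mul_sum, Finset.mul_sum,
    ← Finset.sum_add_distrib]
  refine Finset.sum_congr rfl fun k _ => ?_
  ring

/-- With `X_n` the centred number of white balls and `m = n + (a₀ + b₀) / N`, the fraction of white
balls is `(ℓ + X_n / m) / N`; hence the conditional mean of `a_n - ℓ` is `-α₁ X_n / m`, and the
conditional variance of `a_n` is a polynomial in `X_n / m` with value `D` at `0`. -/
theorem isStochasticApproximation [IsFiniteMeasure μ₁] [IsFiniteMeasure μ₂]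
    (h : IsUrn N a₀ b₀ μ₁ μ₂ P c a) (hμ : IsReplacement N μ₁ μ₂) (hN : 1 ≤ N)
    (hab : 1 ≤ a₀ + b₀) (hα : alpha N μ₁ μ₂ 1 + 1 ≠ 0) :
    IsStochasticApproximation P (history c a) (alpha N μ₁ μ₂ 1) (((a₀ : ℝ) + b₀) / N)
      (D N μ₁ μ₂) (centred N a₀ b₀ (ell N μ₁ μ₂) a) := by
  have hN' : (0 : ℝ) < N := by exact_mod_cast hN
  have hab' : (0 : ℝ) < (a₀ : ℝ) + b₀ := by exact_mod_cast hab
  set X := centred N a₀ b₀ (ell N μ₁ μ₂) a with hX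
  set τ : ℝ := ((a₀ : ℝ) + b₀) / N with hτ
  set α : ℝ := alpha N μ₁ μ₂ 1 with hαdef
  set l : ℝ := ell N μ₁ μ₂ with hl
  set p := whiteFraction N a₀ b₀ a with hp
  have hτ0 : 0 < τ := by positivity
  have hl1 : l * (α + 1) = mom μ₂ 1 := by
    rw [hl, ell, ← hαdef, div_mul_cancel₀ _ hα]
  have hmom : ∀ j, mom μ₁ j = mom μ₂ j - alpha N μ₁ μ₂ j * N := by
    intro j
    rw [alpha]
    field_simp
    ring
  have hNp : ∀ n ω, X n ω / (n + τ) = N * p n ω - l := by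
    intro n ω
    have h1 : (a₀ : ℝ) + b₀ + n * N = N * (n + τ) := by rw [hτ]; field_simp; ring
    have h2 : (0 : ℝ) < n + τ := by positivity
    simp only [hX, hp, centred, whiteFraction, h1, ← hτ]
    field_simp
  have hnoise : ∀ n ω, noise α τ X n ω = a n ω - (mom μ₂ 1 - α * N * p n ω) := by
    intro n ω
    have h1 : X (n + 1) ω = X n ω + a n ω - l := by
      simp only [hX, centred, whiteBalls, totalAdded, Finset.sum_range_succ]
      push_cast
      ring
    have h2 : noise α τ X n ω = a n ω - l + α * (X n ω / (n + τ)) := by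
      rw [noise, h1]
      ring
    rw [h2, hNp, ← hl1]
    ring
  have hE1 : ∀ n, P[fun ω => (a n ω : ℝ) | history c a n] =ᵐ[P]
      fun ω => mom μ₂ 1 - α * N * p n ω := by
    intro n
    have := h.condExp_added_pow hμ n 1
    simp only [pow_one] at this
    filter_upwards [this] with ω hω
    rw [hω, hmom 1]
    ring
  have hnoise_ae : ∀ n, noise α τ X n =ᵐ[P]
      (fun ω => (a n ω : ℝ)) - P[fun ω => (a n ω : ℝ) | history c a n] := by
    intro n
    filter_upwards [hE1 n] with ω hω
    rw [hnoise, Pi.sub_apply, hω]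
  refine ⟨h.history_le, ?_, ?_, ?_, ?_, ?_⟩
  · intro n
    have h1 := measurable_whiteBalls (a₀ := a₀) c a n
    have h2 : Measurable fun z : ℤ => (z : ℝ) - l * (n + τ) := by fun_prop
    exact h2.comp h1
  · refine ⟨|(a₀ : ℝ) - l * τ|, .of_forall fun ω => ?_⟩
    simp [hX, centred, whiteBalls, totalAdded, hτ]
  · refine ⟨(N + 1) + (|mom μ₂ 1| + |α| * N), fun n => ?_⟩
    filter_upwards [h.added_mem hμ n, h.whiteFraction_mem_Icc n] with ω h1 h2
    rw [Finset.mem_Icc] at h1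
    have h3 : (-1 : ℝ) ≤ a n ω := by exact_mod_cast h1.1
    have h4 : (a n ω : ℝ) ≤ N + 1 := by exact_mod_cast h1.2
    have h5 : |α * N * p n ω| ≤ |α| * N := by
      rw [abs_mul, abs_mul, abs_of_pos hN', abs_of_nonneg h2.1]
      exact mul_le_of_le_one_right (by positivity) h2.2
    have h6 : |(a n ω : ℝ)| ≤ N + 1 := abs_le.2 ⟨by linarith, h4⟩
    rw [hnoise]
    refine (abs_sub _ _).trans (add_le_add h6 ((abs_sub _ _).trans (by gcongr)))
  · intro n
    have i1 : Integrable (fun ω => (a n ω : ℝ)) P := (h.memLp_added hμ n 1).integrable le_rfl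
    have e1 := condExp_congr_ae (m := history c a n) (hnoise_ae n)
    have e2 := condExp_sub i1 (integrable_condExp (m := history c a n)
      (f := fun ω => (a n ω : ℝ)) (μ := P)) (history c a n)
    rw [condExp_of_stronglyMeasurable (h.history_le n) stronglyMeasurable_condExp
      integrable_condExp, sub_self] at e2
    exact e1.trans e2
  · refine ⟨|alpha N μ₁ μ₂ 2| + 2 * |l * α| + α ^ 2 * (N + |l|), fun n => ?_⟩
    have e1 : (fun ω => noise α τ X n ω ^ 2) =ᵐ[P]
        ((fun ω => (a n ω : ℝ)) - P[fun ω => (a n ω : ℝ) | history c a n]) ^ 2 := by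
      filter_upwards [hnoise_ae n] with ω hω
      rw [hω, Pi.pow_apply]
    have e2 := condVar_ae_eq_condExp_sq_sub_sq_condExp (h.history_le n) (h.memLp_added hμ n 2)
    have e3 := h.condExp_added_pow hμ n 2
    filter_upwards [condExp_congr_ae (m := history c a n) e1, e2, e3, hE1 n,
      h.whiteFraction_mem_Icc n] with ω e1 e2 e3 e4 e5
    have e6 : P[fun ω => noise α τ X n ω ^ 2 | history c a n] ω =
        p n ω * mom μ₁ 2 + (1 - p n ω) * mom μ₂ 2 - (mom μ₂ 1 - α * N * p n ω) ^ 2 := by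
      rw [e1, ← e4, ← e3]
      exact e2
    set x : ℝ := X n ω / (n + τ) with hx
    have hxp : N * p n ω = l + x := by rw [hx, hNp]; ring
    have hxle : |x| ≤ N + |l| := by
      rw [hx, hNp]
      refine (abs_sub _ _).trans (add_le_add_left ?_ _)
      rw [abs_mul, abs_of_pos hN', abs_of_nonneg e5.1]
      exact mul_le_of_le_one_right hN'.le e5.2
    have hdiff : P[fun ω => noise α τ X n ω ^ 2 | history c a n] ω - D N μ₁ μ₂ =
        (-alpha N μ₁ μ₂ 2 + 2 * (l * α) - α ^ 2 * x) * x := by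
      have h1 : p n ω * mom μ₁ 2 + (1 - p n ω) * mom μ₂ 2 =
          mom μ₂ 2 - alpha N μ₁ μ₂ 2 * (l + x) := by
        rw [hmom 2, ← hxp]
        ring
      rw [e6, h1, mul_assoc α, hxp, ← hl1, D, ← hl]
      ring
    have hxabs : |X n ω| / (n + τ) = |x| := by
      rw [hx, abs_div, abs_of_pos (a := (n : ℝ) + τ) (by positivity)]
    rw [hdiff, hxabs, abs_mul]
    gcongr
    calc _ ≤ |-alpha N μ₁ μ₂ 2 + 2 * (l * α)| + |α ^ 2 * x| := abs_sub _ _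
      _ ≤ (|-alpha N μ₁ μ₂ 2| + |2 * (l * α)|) + |α ^ 2 * x| := by gcongr; exact abs_add_le _ _
      _ = (|alpha N μ₁ μ₂ 2| + 2 * |l * α|) + α ^ 2 * |x| := by
        rw [abs_neg, abs_mul 2, abs_two, abs_mul (α ^ 2), abs_of_nonneg (sq_nonneg α)]
      _ ≤ _ := by gcongr

end IsUrn

end Urn

/-! ### The limit variance and the degenerate laws -/

section Variance

variable {N : ℕ} {μ μ₁ μ₂ : Measure ℤ}

theorem r_eq_integral : r N μ = ∫ x : ℤ, (x : ℝ) / N ∂μ := by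
  rw [integral_div, r, mom]
  simp

theorem v_eq [IsProbabilityMeasure μ] {s : Finset ℤ} (h : ∀ᵐ x ∂μ, x ∈ s) :
    v N μ = mom μ 2 / N ^ 2 - r N μ ^ 2 := by
  have hL : MemLp (fun x : ℤ => (x : ℝ) / N) 2 μ := by
    simpa [div_eq_mul_inv] using (memLp_intCast h 2).mul_const ((N : ℝ)⁻¹)
  rw [v, variance_eq_sub hL, r_eq_integral, mom, ← integral_div]
  simp [div_pow]

theorem D_eq [IsProbabilityMeasure μ₁] [IsProbabilityMeasure μ₂]
    (hμ : IsReplacement N μ₁ μ₂) (hN : 1 ≤ N) (hα : alpha N μ₁ μ₂ 1 + 1 ≠ 0) :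
    D N μ₁ μ₂ = N ^ 2 * (R N μ₁ μ₂ + S N μ₁ μ₂) / (alpha N μ₁ μ₂ 1 + 1) ^ 2 := by
  have hN' : (N : ℝ) ≠ 0 := by positivity
  have h1 : mom μ₁ 1 = N * r N μ₁ := by rw [r]; field_simp
  have h2 : mom μ₂ 1 = N * r N μ₂ := by rw [r]; field_simp
  have h3 : mom μ₁ 2 = N ^ 2 * (v N μ₁ + r N μ₁ ^ 2) := by
    rw [v_eq hμ.ae_mem_white]; field_simp; ring
  have h4 : mom μ₂ 2 = N ^ 2 * (v N μ₂ + r N μ₂ ^ 2) := by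
    rw [v_eq hμ.ae_mem_black]; field_simp; ring
  have h5 : alpha N μ₁ μ₂ 1 = r N μ₂ - r N μ₁ := by rw [alpha, r, r]; ring
  have h6 : alpha N μ₁ μ₂ 2 =
      N * (v N μ₂ + r N μ₂ ^ 2 - (v N μ₁ + r N μ₁ ^ 2)) := by
    rw [alpha, h3, h4]; field_simp
  rw [h5] at hα
  rw [D, ell, R, S, h6, h5, h4, h2]
  field_simp
  ring

theorem eq_dirac_of_ae_eq [IsProbabilityMeasure μ] {k : ℤ} (h : ∀ᵐ x ∂μ, x = k) :
    μ = Measure.dirac k := by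
  have h1 : μ.map id = μ.map (fun _ => k) := Measure.map_congr h
  rwa [Measure.map_id, Measure.map_const, measure_univ, one_smul] at h1

theorem integrable_div [IsProbabilityMeasure μ] {s : Finset ℤ} (h : ∀ᵐ x ∂μ, x ∈ s) :
    Integrable (fun x : ℤ => (x : ℝ) / N) μ :=
  ((memLp_intCast h 1).integrable le_rfl).div_const _

theorem r_dirac (k : ℤ) : r N (Measure.dirac k) = k / N := by
  rw [r, mom, integral_dirac, pow_one]

theorem v_dirac (k : ℤ) : v N (Measure.dirac k) = 0 := by
  rw [v, variance_dirac]

theorem r_white_le_one [IsProbabilityMeasure μ₁] (hμ : IsReplacement N μ₁ μ₂) (hN : 1 ≤ N) :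
    r N μ₁ ≤ 1 := by
  have hN' : (0 : ℝ) < N := by exact_mod_cast hN
  rw [r_eq_integral]
  have h : ∫ x : ℤ, (x : ℝ) / N ∂μ₁ ≤ ∫ _, (1 : ℝ) ∂μ₁ := by
    refine integral_mono_ae (integrable_div hμ.ae_mem_white) (integrable_const _) ?_
    filter_upwards [hμ.white] with x hx
    rw [div_le_one hN']
    exact_mod_cast hx.2
  simpa using h

theorem r_black_nonneg (hμ : IsReplacement N μ₁ μ₂) : 0 ≤ r N μ₂ := by
  rw [r_eq_integral]
  refine integral_nonneg_of_ae ?_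
  filter_upwards [hμ.black] with x hx
  have : (0 : ℝ) ≤ x := by exact_mod_cast (by omega : 0 ≤ x)
  simp only [Pi.zero_apply]
  positivity

theorem r_white_eq_one_iff [IsProbabilityMeasure μ₁] (hμ : IsReplacement N μ₁ μ₂) (hN : 1 ≤ N) :
    r N μ₁ = 1 ↔ μ₁ = Measure.dirac (N : ℤ) := by
  have hN' : (0 : ℝ) < N := by exact_mod_cast hN
  constructor
  · intro h
    have hint := integrable_div (N := N) hμ.ae_mem_white
    have h0 : ∫ x : ℤ, (1 - (x : ℝ) / N) ∂μ₁ = 0 := by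
      rw [integral_sub (integrable_const _) hint, ← r_eq_integral, h]
      simp
    have hint' : Integrable (fun x : ℤ => 1 - (x : ℝ) / N) μ₁ := (integrable_const _).sub hint
    rw [integral_eq_zero_iff_of_nonneg_ae ?_ hint'] at h0
    · refine eq_dirac_of_ae_eq ?_
      filter_upwards [h0] with x hx
      simp only [Pi.zero_apply] at hx
      have : (x : ℝ) = N := by field_simp at hx; linarith
      exact_mod_cast this
    · filter_upwards [hμ.white] with x hx
      simp only [Pi.zero_apply]
      rw [sub_nonneg, div_le_one hN']
      exact_mod_cast hx.2
  · intro h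
    rw [h, r_dirac, Int.cast_natCast, div_self hN'.ne']

theorem r_black_eq_zero_iff [IsProbabilityMeasure μ₂] (hμ : IsReplacement N μ₁ μ₂)
    (hN : 1 ≤ N) :
    r N μ₂ = 0 ↔ μ₂ = Measure.dirac 0 := by
  have hN' : (0 : ℝ) < N := by exact_mod_cast hN
  constructor
  · intro h
    rw [r_eq_integral, integral_eq_zero_iff_of_nonneg_ae ?_ (integrable_div hμ.ae_mem_black)] at h
    · refine eq_dirac_of_ae_eq ?_
      filter_upwards [h] with x hx
      simp only [Pi.zero_apply] at hx
      have : (x : ℝ) = 0 := by field_simp at hx; linarith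
      exact_mod_cast this
    · filter_upwards [hμ.black] with x hx
      have : (0 : ℝ) ≤ x := by exact_mod_cast (by omega : 0 ≤ x)
      simp only [Pi.zero_apply]
      positivity
  · intro h
    rw [h, r_dirac, Int.cast_zero, zero_div]

theorem v_nonneg : 0 ≤ v N μ := variance_nonneg _ _

/-- A law with variance `0` is a point mass; the atom is an integer because the law lives on `ℤ`. -/
theorem exists_eq_dirac_of_v_eq_zero [IsProbabilityMeasure μ] {s : Finset ℤ}
    (h : ∀ᵐ x ∂μ, x ∈ s) (hN : 1 ≤ N) (hv : v N μ = 0) : ∃ k : ℤ, μ = Measure.dirac k := by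
  have hN' : (0 : ℝ) < N := by exact_mod_cast hN
  have hL : MemLp (fun x : ℤ => (x : ℝ) / N) 2 μ := by
    simpa [div_eq_mul_inv] using (memLp_intCast h 2).mul_const ((N : ℝ)⁻¹)
  have h1 := ae_eq_integral_of_variance_eq_zero hL hv
  obtain ⟨k, hk⟩ := h1.exists
  refine ⟨k, eq_dirac_of_ae_eq ?_⟩
  filter_upwards [h1] with x hx
  rw [← hk, div_left_inj' hN'.ne'] at hx
  exact_mod_cast hx

theorem R_nonneg [IsProbabilityMeasure μ₁] (hμ : IsReplacement N μ₁ μ₂) (hN : 1 ≤ N) :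
    0 ≤ R N μ₁ μ₂ :=
  mul_nonneg (mul_nonneg (r_black_nonneg hμ) (sq_nonneg _))
    (sub_nonneg.2 (r_white_le_one hμ hN))

theorem S_nonneg [IsProbabilityMeasure μ₁] (hμ : IsReplacement N μ₁ μ₂) (hN : 1 ≤ N)
    (hα : 0 < alpha N μ₁ μ₂ 1 + 1) :
    0 ≤ S N μ₁ μ₂ :=
  mul_nonneg hα.le (add_nonneg
    (mul_nonneg v_nonneg (sub_nonneg.2 (r_white_le_one hμ hN)))
    (mul_nonneg v_nonneg (r_black_nonneg hμ)))

/-- `D = 0` forces `R = S = 0`: either a colour is absorbing (`r₁ = 1` or `r₂ = 0`), or `α₁ = 0` and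
both variances vanish. -/
theorem D_eq_zero_iff [IsProbabilityMeasure μ₁] [IsProbabilityMeasure μ₂]
    (hμ : IsReplacement N μ₁ μ₂) (hN : 1 ≤ N) (hα : 0 < alpha N μ₁ μ₂ 1 + 1) :
    D N μ₁ μ₂ = 0 ↔ IsDegenerate N μ₁ μ₂ := by
  have hN' : (0 : ℝ) < N := by exact_mod_cast hN
  have hR := R_nonneg hμ hN
  have hS := S_nonneg hμ hN hα
  have h1 : D N μ₁ μ₂ = 0 ↔ R N μ₁ μ₂ = 0 ∧ S N μ₁ μ₂ = 0 := by
    rw [D_eq hμ hN hα.ne', div_eq_zero_iff, mul_eq_zero, add_eq_zero_iff_of_nonneg hR hS]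
    simp [hN'.ne', hα.ne']
  have hαr : alpha N μ₁ μ₂ 1 = r N μ₂ - r N μ₁ := by rw [alpha, r, r]; ring
  rw [h1]
  constructor
  · rintro ⟨hR0, hS0⟩
    by_cases hw : r N μ₁ = 1
    · exact Or.inl ((r_white_eq_one_iff hμ hN).1 hw)
    by_cases hb : r N μ₂ = 0
    · exact Or.inr (Or.inl ((r_black_eq_zero_iff hμ hN).1 hb))
    have hw' : 0 < 1 - r N μ₁ := sub_pos.2 (lt_of_le_of_ne (r_white_le_one hμ hN) hw)
    have hb' : 0 < r N μ₂ := lt_of_le_of_ne (r_black_nonneg hμ) (Ne.symm hb)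
    have hα0 : alpha N μ₁ μ₂ 1 = 0 := by
      rw [R, mul_eq_zero, mul_eq_zero] at hR0
      rcases hR0 with (h | h) | h
      · exact absurd h hb
      · exact pow_eq_zero_iff two_ne_zero |>.1 h
      · exact absurd h hw'.ne'
    rw [S, mul_eq_zero, or_iff_right hα.ne', add_eq_zero_iff_of_nonneg
      (mul_nonneg v_nonneg hw'.le) (mul_nonneg v_nonneg hb'.le), mul_eq_zero, mul_eq_zero,
      or_iff_left hw'.ne', or_iff_left hb] at hS0
    obtain ⟨k₁, hk₁⟩ := exists_eq_dirac_of_v_eq_zero hμ.ae_mem_white hN hS0.2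
    obtain ⟨k₂, hk₂⟩ := exists_eq_dirac_of_v_eq_zero hμ.ae_mem_black hN hS0.1
    have hk : k₂ = k₁ := by
      rw [hαr, hk₁, hk₂, r_dirac, r_dirac, sub_eq_zero, div_left_inj' hN'.ne'] at hα0
      exact_mod_cast hα0
    exact Or.inr (Or.inr ⟨k₁, hk₁, hk ▸ hk₂⟩)
  · rintro (h | h | ⟨k, h, h'⟩)
    · have h2 := (r_white_eq_one_iff hμ hN).2 h
      have h3 : v N μ₁ = 0 := by rw [h, v_dirac]
      simp [R, S, h2, h3]
    · have h2 := (r_black_eq_zero_iff hμ hN).2 h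
      have h3 : v N μ₂ = 0 := by rw [h, v_dirac]
      simp [R, S, h2, h3]
    · have h2 : v N μ₁ = 0 := by rw [h, v_dirac]
      have h3 : v N μ₂ = 0 := by rw [h', v_dirac]
      have h4 : alpha N μ₁ μ₂ 1 = 0 := by rw [hαr, h, h', sub_self]
      simp [R, S, h2, h3, h4]

end Variance

end PolyaUrn

theorem mainTheorem3 {Ω : Type*} [MeasurableSpace Ω] (P : Measure Ω) [IsProbabilityMeasure P]
    (N a₀ b₀ : ℕ) (hN : 1 ≤ N) (hab : 1 ≤ a₀ + b₀)
    (μ₁ μ₂ : Measure ℤ) [IsProbabilityMeasure μ₁] [IsProbabilityMeasure μ₂]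
    (hμ : PolyaUrn.IsReplacement N μ₁ μ₂)
    (c : ℕ → Ω → Bool) (a : ℕ → Ω → ℤ)
    (hurn : PolyaUrn.IsUrn N a₀ b₀ μ₁ μ₂ P c a)
    (hρ : PolyaUrn.rho N μ₁ μ₂ < 1 / 2) :
    (¬ PolyaUrn.IsDegenerate N μ₁ μ₂ →
      0 < PolyaUrn.D N μ₁ μ₂ / (2 * PolyaUrn.alpha N μ₁ μ₂ 1 + 1) ∧
      TendstoInDistribution
        (fun (n : ℕ) ω =>
          ((PolyaUrn.totalAdded a n ω : ℝ) - n * PolyaUrn.ell N μ₁ μ₂) / √(n : ℝ))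
        atTop (id : ℝ → ℝ) (fun _ => P)
        (gaussianReal 0
          (PolyaUrn.D N μ₁ μ₂ / (2 * PolyaUrn.alpha N μ₁ μ₂ 1 + 1)).toNNReal) ∧
      TendstoInDistribution
        (fun (n : ℕ) ω =>
          ((PolyaUrn.whiteBalls a₀ a n ω : ℝ) - n * PolyaUrn.ell N μ₁ μ₂) / √(n : ℝ))
        atTop (id : ℝ → ℝ) (fun _ => P)
        (gaussianReal 0
          (PolyaUrn.D N μ₁ μ₂ / (2 * PolyaUrn.alpha N μ₁ μ₂ 1 + 1)).toNNReal)) ∧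
    PolyaUrn.D N μ₁ μ₂ / (2 * PolyaUrn.alpha N μ₁ μ₂ 1 + 1) =
      (N : ℝ) ^ 2 * (PolyaUrn.R N μ₁ μ₂ + PolyaUrn.S N μ₁ μ₂) /
        ((2 * PolyaUrn.alpha N μ₁ μ₂ 1 + 1) * (PolyaUrn.alpha N μ₁ μ₂ 1 + 1) ^ 2) ∧
    0 ≤ PolyaUrn.R N μ₁ μ₂ ∧ 0 ≤ PolyaUrn.S N μ₁ μ₂ ∧
    (PolyaUrn.D N μ₁ μ₂ = 0 ↔ PolyaUrn.IsDegenerate N μ₁ μ₂) := by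
  have hα : -(1 / 2) < PolyaUrn.alpha N μ₁ μ₂ 1 := by
    have : PolyaUrn.alpha N μ₁ μ₂ 1 = -PolyaUrn.rho N μ₁ μ₂ := by
      rw [PolyaUrn.alpha, PolyaUrn.rho]
      ring
    linarith
  have hα1 : 0 < PolyaUrn.alpha N μ₁ μ₂ 1 + 1 := by linarith
  have hα2 : 0 < 2 * PolyaUrn.alpha N μ₁ μ₂ 1 + 1 := by linarith
  have hN' : (0 : ℝ) < N := by exact_mod_cast hN
  have hR := PolyaUrn.R_nonneg hμ hN
  have hS := PolyaUrn.S_nonneg hμ hN hα1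
  have hD := PolyaUrn.D_eq hμ hN hα1.ne'
  have hD0 : 0 ≤ PolyaUrn.D N μ₁ μ₂ := by rw [hD]; positivity
  have hDiff := PolyaUrn.D_eq_zero_iff hμ hN hα1
  refine ⟨fun hdeg => ⟨?_, ?_, ?_⟩, ?_, hR, hS, hDiff⟩
  · exact div_pos (lt_of_le_of_ne hD0 fun h => hdeg (hDiff.1 h.symm)) hα2
  · have hab' : (0 : ℝ) < (a₀ : ℝ) + b₀ := by exact_mod_cast hab
    convert (hurn.isStochasticApproximation hμ hN hab hα1.ne').tendstoInDistribution hα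
      (by positivity) hD0 (PolyaUrn.ell N μ₁ μ₂ * (((a₀ : ℝ) + b₀) / N) - a₀) using 4
    simp only [PolyaUrn.centred, PolyaUrn.whiteBalls]
    push_cast
    ring
  · have hab' : (0 : ℝ) < (a₀ : ℝ) + b₀ := by exact_mod_cast hab
    convert (hurn.isStochasticApproximation hμ hN hab hα1.ne').tendstoInDistribution hα
      (by positivity) hD0 (PolyaUrn.ell N μ₁ μ₂ * (((a₀ : ℝ) + b₀) / N)) using 4
    simp only [PolyaUrn.centred]
    ring
  · rw [hD, div_div, mul_comm (2 * PolyaUrn.alpha N μ₁ μ₂ 1 + 1)]
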